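/- Let $G$ be a countable nonabelian torsion-free CSA group (CSA: every maximal abelian subgroup $M$ is malnormal, i.e. $M\cap g^{-1}Mg=1$ for all $g\notin M$). For a group $A$ and $1\ne u\in A$, the extension of the centralizer of $u$ is $A(u,t)=\langle A,t\mid [c,t]=1,\ c\in C_A(u)\rangle$. A group $B\ge A$ is a finite iterated centralizer extension of $A$, written $A\le_{ICE}B$, if there is a finite chain $A=A_0\le A_1\le\dots\le A_k=B$, $k\ge 0$, such that each $A_{i+1}$ is isomorphic over $A_i$ to $A_i(u_i,t_i)$ for some $1\neq u_i\in A_i$. An embedding $\phi:A\to B$ is an ICE-embedding if $\phi(A)\le_{ICE}B$. A $G$-group is a group $A$ with a homomorphism $G\to A$, and $G$-isomorphisms are isomorphisms compatible with these homomorphisms. $ICE(G)$ is the class of $G$-groups $A$ for which $G\to A$ is an ICE-embedding. An ICE-chain for a $G$-group $H$ is a chain $M_0\le_{ICE}M_1\le_{ICE}\cdots$ of subgroups of $H$, each containing the image of $G$ and belonging to $ICE(G)$, with $\bigcup_n M_n=H$. For a subgroup $A$ of $H$ containing the image of $G$, write $A\le_{ICE}H$ if $A\le_{ICE}M_n$ for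 some ICE-chain $(M_i)$ for $H$ and some $n$. The ICE-age of $H$ is the class of all $G$-groups that are $G$-isomorphic to some $A\le_{ICE}H$. Then there exists a countable $G$-group $H$ with the following properties: 1. $H$ is the union of an ICE-chain of groups in $ICE(G)$; 2. the ICE-age of $H$ is exactly $ICE(G)$; 3. every $G$-isomorphism between two subgroups $A,B\le_{ICE}H$ extends to an automorphism of $H$. Moreover, any two countable $G$-groups with properties 1-3 are $G$-isomorphic. -/

import Mathlib

universe u

/-- A subgroup is maximal abelian if it is maximal, for inclusion, among the abelian subgroups. -/
def Subgroup.IsMaximalAbelian {G : Type u} [Group G] (M : Subgroup G) : Prop :=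
  Maximal (fun K : Subgroup G => ∀ x ∈ K, ∀ y ∈ K, x * y = y * x) M

/-- `M` is malnormal: `M ∩ g⁻¹ M g = 1` for every `g ∉ M`. -/
def Subgroup.IsMalnormal {G : Type u} [Group G] (M : Subgroup G) : Prop :=
  ∀ g : G, g ∉ M → ∀ x ∈ M, g * x * g⁻¹ ∈ M → x = 1

/-- CSA group (conjugately separated abelian): every maximal abelian subgroup is malnormal. -/
def IsCSAGroup (G : Type u) [Group G] : Prop :=
  ∀ M : Subgroup G, M.IsMaximalAbelian → M.IsMalnormal

/-- No element other than `1` has finite order. -/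
def IsTorsionFreeGroup (G : Type u) [Group G] : Prop :=
  ∀ g : G, g ≠ 1 → ¬ IsOfFinOrder g

/-- The extension of the centralizer of `v` by one letter,
`G(v, t) = ⟨G, t | [c, t] = 1 for c ∈ C_G(v)⟩`:
the HNN extension of `G` along the identity map of `C_G(v)`. -/
abbrev CentralizerExtension (G : Type u) [Group G] (v : G) : Type u :=
  HNNExtension G (Subgroup.centralizer {v}) (Subgroup.centralizer {v}) (MulEquiv.refl _)

/-- For subgroups `K`, `L` of an ambient group: `K ≤ L`, and `L` is obtained from `K` by a single
extension of the centralizer of a nontrivial element, that is, `L` is isomorphic over `K`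
to `K(v, t)` for some `v ≠ 1` in `K`. -/
def IsCEStep {H : Type u} [Group H] (K L : Subgroup H) : Prop :=
  ∃ h : K ≤ L, ∃ v : K, v ≠ 1 ∧ ∃ e : CentralizerExtension K v ≃* L,
    ∀ k : K, e (HNNExtension.of k) = Subgroup.inclusion h k

/-- For subgroups `K`, `L` of an ambient group: `L` is a finite (possibly empty) iterated
centralizer extension of `K`. -/
def IsICE {H : Type u} [Group H] (K L : Subgroup H) : Prop :=
  Relation.ReflTransGen IsCEStep K L

/-- An ICE-embedding: an embedding `φ : A → B` such that `B` is a finite iterated centralizer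
extension of `φ(A)`. -/
def IsICEEmbedding {A B : Type u} [Group A] [Group B] (φ : A →* B) : Prop :=
  Function.Injective φ ∧ IsICE φ.range ⊤

/-- The class `ICE(G)`: the `G`-group `ι : G → A` is a finite iterated centralizer
extension of (the embedded copy of) `G`. -/
def MemICE {G A : Type u} [Group G] [Group A] (ι : G →* A) : Prop :=
  IsICEEmbedding ι

/-- A subgroup `K` of the `G`-group `j : G → H`, as a `G`-group, belongs to `ICE(G)`. -/
def SubgroupMemICE {G H : Type u} [Group G] [Group H] (j : G →* H) (K : Subgroup H) : Prop :=
  ∃ h : ∀ g, j g ∈ K, MemICE (j.codRestrict K h)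

/-- The `G`-group `j : G → H` is the union of the ICE-chain
`M 0 ≤ M 1 ≤ ⋯` of `G`-groups from `ICE(G)`. -/
structure IsICEChain {G H : Type u} [Group G] [Group H] (j : G →* H) (M : ℕ → Subgroup H) :
    Prop where
  mem : ∀ n, SubgroupMemICE j (M n)
  step : ∀ n, IsICE (M n) (M (n + 1))
  union : ∀ h : H, ∃ n, h ∈ M n

/-- `K ≤_ICE H` for a `G`-subgroup `K` of the `G`-group `j : G → H`: some member of an ICE-chain of
groups from `ICE(G)` with union `H` is a finite iterated centralizer extension of `K`. -/
def IsICESubgroup {G H : Type u} [Group G] [Group H] (j : G →* H) (K : Subgroup H) : Prop :=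
  j.range ≤ K ∧ ∃ M : ℕ → Subgroup H, IsICEChain j M ∧ ∃ n, IsICE K (M n)

/-- The `G`-group `ι : G → A` belongs to the ICE-age of the `G`-group `j : G → H`: it is
`G`-isomorphic to an ICE-subgroup of `H`. -/
def MemICEAge {G H A : Type u} [Group G] [Group H] [Group A] (j : G →* H) (ι : G →* A) : Prop :=
  ∃ K : Subgroup H, IsICESubgroup j K ∧ ∃ e : A ≃* K, ∀ g, (e (ι g) : H) = j g

/-- The `G`-group `j : G → H` is a Fraïssé limit of `ICE(G)` with respect to ICE-embeddings. -/
structure IsICEFraisseLimit {G H : Type u} [Group G] [Group H] (j : G →* H) : Prop where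
  countable : Countable H
  /-- `H` is the union of an ICE-chain of groups in `ICE(G)`. -/
  chain : ∃ M : ℕ → Subgroup H, IsICEChain j M
  /-- The ICE-age of `H` is exactly `ICE(G)`. -/
  age : ∀ (A : Type u) [Group A] (ι : G →* A), MemICEAge j ι ↔ MemICE ι
  /-- Every `G`-isomorphism between ICE-subgroups of `H` extends to an automorphism of `H`. -/
  homogeneous : ∀ K L : Subgroup H, IsICESubgroup j K → IsICESubgroup j L →
    ∀ f : K ≃* L, (∀ (g : G) (k : K), (k : H) = j g → (f k : H) = j g) →
      ∃ σ : H ≃* H, ∀ k : K, σ (k : H) = (f k : H)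

/-! ICE(G) behaves like a Fraïssé class, and its limit is reached by extending centralizers forever.

Put C = C_A(u). The extension A(u,t) is the semidirect product of A with the free group on A/C, the
basis letter gC standing for g t g⁻¹. It acts on the Cayley tree of the free group, and A is the
stabilizer of the vertex 1. Hence every element is conjugate either into A or to an element
translating along an axis through 1. Up to conjugacy, the centralizer of a nontrivial element lies
in A, lies in C × ⟨t⟩, or is cyclic. It follows that the extension is again torsion-free CSA
(`CosetFreeProduct.isTorsionFreeCSA`).

Inside a torsion-free CSA group, consecutive extensions commute when both are taken at elements of
the bottom group (`IsCE.swap`). So if the centralizer of v ∈ K grows anywhere in an iterated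
extension M of K, a letter for v can be moved to the front: M is an iterated extension of some
K(v,s) (`IsICEOfLength.exists_letter`). Cancellation (`IsICE.of_isICE_of_le`) also holds: if G ≤ K
and M is an iterated extension of both, then K is one of G.

Existence: take the union of a tower in which the centralizer of every nontrivial element grows
beyond every stage. By the letter lemma, each ICE-subgroup L then has all its extensions L(v,s)
among the ICE-subgroups. Back and forth over ICE-subgroups gives homogeneity, the same extension
property embeds all of ICE(G), and cancellation shows that the age is no larger.

Uniqueness: in any limit, the age condition and homogeneity together yield this extension property
(`IsICEFraisseLimit.hasCentralizerExtensions`), so back and forth between two limits can start from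
the two copies of G. -/

section

/-! ### Free groups as trees, and centralizers of hyperbolic isometries -/

/-- The length of the longest common prefix of two lists. -/
def List.commonPrefixLength {α : Type*} [DecidableEq α] : List α → List α → ℕ
  | [], _ => 0
  | _ :: _, [] => 0
  | x :: l, y :: m => if x = y then l.commonPrefixLength m + 1 else 0

/-- This ultrametric inequality is the source of the four-point condition, since the common prefix
length is the Gromov product based at 1. -/
theorem List.min_commonPrefixLength_le {α : Type*} [DecidableEq α] (k l m : List α) :
    min (k.commonPrefixLength l) (l.commonPrefixLength m) ≤ k.commonPrefixLength m := by
  induction k generalizing l m with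
  | nil => simp [List.commonPrefixLength]
  | cons x k ih =>
    rcases l with _ | ⟨y, l⟩
    · simp [List.commonPrefixLength]
    rcases m with _ | ⟨z, m⟩
    · simp [List.commonPrefixLength]
    have := ih l m
    simp only [List.commonPrefixLength]
    split_ifs <;> first | omega | (exfalso; simp_all)

namespace FreeGroup

variable {α : Type*} [DecidableEq α]

theorem norm_mk_of_isReduced {L : List (α × Bool)} (h : IsReduced L) : (mk L).norm = L.length := by
  rw [norm, toWord_mk, h.reduce_eq]

/-- Once the common prefix is cancelled the first letters differ, so the inverse of one word
followed by the other is already reduced. -/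
theorem norm_inv_mul_add (L M : List (α × Bool)) (hL : IsReduced L) (hM : IsReduced M) :
    ((mk L)⁻¹ * mk M).norm + 2 * L.commonPrefixLength M = L.length + M.length := by
  induction L generalizing M with
  | nil =>
    have := norm_mk_of_isReduced hM
    simp only [List.commonPrefixLength, List.length_nil]
    rw [show (mk ([] : List (α × Bool))) = 1 from rfl]
    simpa using this
  | cons x L ih =>
    rcases M with _ | ⟨y, M⟩
    · have := norm_mk_of_isReduced hL
      simp only [List.commonPrefixLength, List.length_nil]
      rw [show (mk ([] : List (α × Bool))) = 1 from rfl, mul_one, norm_inv_eq, this]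
    · by_cases hxy : x = y
      · subst hxy
        have h := ih M (hL.infix (List.suffix_cons _ _).isInfix)
          (hM.infix (List.suffix_cons _ _).isInfix)
        have e : (mk (x :: L))⁻¹ * mk (x :: M) = (mk L)⁻¹ * mk M := by
          rw [show x :: L = [x] ++ L from rfl, show x :: M = [x] ++ M from rfl, ← mul_mk, ← mul_mk]
          group
        rw [e]
        simp only [List.commonPrefixLength, if_true, List.length_cons]
        omega
      · have e : (mk (x :: L))⁻¹ * mk (y :: M) = mk (invRev (x :: L) ++ y :: M) := by
          rw [inv_mk, mul_mk]
        have hr : IsReduced (invRev (x :: L) ++ y :: M) := by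
          rw [IsReduced, List.isChain_append]
          refine ⟨IsReduced.of_reduce_eq ?_, hM, ?_⟩
          · rw [reduce_invRev, hL.reduce_eq]
          · intro a ha b hb hab
            simp only [List.head?_cons, Option.mem_def, Option.some.injEq] at hb
            subst hb
            simp only [invRev, List.map_cons, List.reverse_cons, List.getLast?_append,
              List.getLast?_singleton, Option.some_or, Option.mem_def, Option.some.injEq] at ha
            subst ha
            rcases x with ⟨x, s⟩
            rcases y with ⟨y, t⟩
            simp only at hab
            subst hab
            cases s <;> cases t <;> simp_all
        rw [e, norm_mk_of_isReduced hr]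
        simp only [List.commonPrefixLength, if_neg hxy, List.length_append, invRev_length]
        omega

/-- The tree metric on the Cayley graph of a free group. -/
def treeDist (f g : FreeGroup α) : ℤ := ((f⁻¹ * g).norm : ℤ)

theorem treeDist_eq_commonPrefixLength (f g : FreeGroup α) :
    treeDist f g = f.norm + g.norm - 2 * f.toWord.commonPrefixLength g.toWord := by
  have := norm_inv_mul_add f.toWord g.toWord isReduced_toWord isReduced_toWord
  rw [mk_toWord, mk_toWord] at this
  simp only [treeDist, norm] at *
  omega

theorem treeDist_mul_left (h f g : FreeGroup α) : treeDist (h * f) (h * g) = treeDist f g := by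
  simp only [treeDist]; congr 2; group

theorem treeDist_comm (f g : FreeGroup α) : treeDist f g = treeDist g f := by
  simp only [treeDist]; rw [← norm_inv_eq]; simp

theorem treeDist_one_left (f : FreeGroup α) : treeDist 1 f = f.norm := by simp [treeDist]

theorem treeDist_four_point (p q r s : FreeGroup α) :
    treeDist p q + treeDist r s ≤ max (treeDist p r + treeDist q s) (treeDist p s + treeDist q r) := by
  -- The case s = 1 is the ultrametric inequality for common prefixes; left translation by s⁻¹
  -- reduces to it.
  have key : ∀ p q r : FreeGroup α, treeDist p q + treeDist r 1 ≤
      max (treeDist p r + treeDist q 1) (treeDist p 1 + treeDist q r) := by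
    intro p q r
    have h := List.min_commonPrefixLength_le p.toWord r.toWord q.toWord
    rw [treeDist_comm r 1, treeDist_comm q 1, treeDist_comm p 1, treeDist_comm q r]
    simp only [treeDist_one_left]
    rw [treeDist_eq_commonPrefixLength p q, treeDist_eq_commonPrefixLength p r,
      treeDist_eq_commonPrefixLength r q]
    omega
  have h := key (s⁻¹ * p) (s⁻¹ * q) (s⁻¹ * r)
  rw [← inv_mul_cancel s] at h
  simpa only [treeDist_mul_left] using h

end FreeGroup

/-- A `0`-hyperbolic integer-valued metric. -/
structure IsTreeDist {V : Type*} (d : V → V → ℤ) : Prop where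
  symm : ∀ x y, d x y = d y x
  self : ∀ x, d x x = 0
  eq_of_zero : ∀ x y, d x y = 0 → x = y
  four : ∀ p q r s, d p q + d r s ≤ max (d p r + d q s) (d p s + d q r)

theorem FreeGroup.isTreeDist {α : Type*} [DecidableEq α] :
    IsTreeDist (FreeGroup.treeDist (α := α)) where
  symm := treeDist_comm
  self x := by simp [treeDist]
  eq_of_zero x y h := by
    simp only [treeDist, Nat.cast_eq_zero, norm_eq_zero] at h
    exact inv_mul_eq_one.mp h
  four := treeDist_four_point

namespace IsTreeDist

variable {V : Type*} {d : V → V → ℤ} (hd : IsTreeDist d)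
include hd

theorem triangle (x y z : V) : d x z ≤ d x y + d y z := by
  have := hd.four x z y y
  rw [hd.self, hd.symm z y] at this
  omega

theorem nonneg (x y : V) : 0 ≤ d x y := by
  have := hd.triangle x y x
  rw [hd.self, hd.symm y x] at this
  omega

variable {H : Type*} [Group H] [MulAction H V] (hi : ∀ (g : H) x y, d (g • x) (g • y) = d x y)
include hi

/-- The hypotheses say that o lies on the axis of h, with translation length l. In a tree a local
geodesic is a geodesic, so the orbit of o advances by l at each step. -/
theorem dist_pow_smul {h : H} {o : V} {l : ℤ} (hl : 0 < l) (h1 : d o (h • o) = l)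
    (h2 : d o (h • h • o) = 2 * l) (n : ℕ) : d o (h ^ n • o) = n * l := by
  have key : ∀ n : ℕ, d o (h ^ n • o) = n * l ∧ d o (h ^ (n + 1) • o) = (n + 1) * l := by
    intro n
    induction n with
    | zero => simp [hd.self, h1]
    | succ n ih =>
      refine ⟨by push_cast; exact ih.2, ?_⟩
      -- For n > 0 one alternative of the four-point condition reads 2(n+1)l ≤ 2l, which is
      -- impossible; for n = 0 that alternative would carry no information.
      rcases Nat.eq_zero_or_pos n with rfl | hn
      · simpa [pow_succ, mul_smul] using by linarith
      have e1 : d (h • o) (h ^ (n + 1 + 1) • o) = (n + 1) * l := by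
        rw [pow_succ' h (n + 1), mul_smul, hi, ih.2]
      have e2 : d (h ^ (n + 1) • o) (h ^ (n + 1 + 1) • o) = l := by
        rw [pow_succ h (n + 1), mul_smul, hi, h1]
      have e3 : d (h ^ (n + 1) • o) (h • o) = n * l := by
        rw [hd.symm, pow_succ' h n, mul_smul, hi, ih.1]
      have f := hd.four o (h ^ (n + 1) • o) (h • o) (h ^ (n + 1 + 1) • o)
      have t := hd.triangle o (h ^ (n + 1) • o) (h ^ (n + 1 + 1) • o)
      rw [e1, e2, e3, ih.2, h1] at f
      rw [e2, ih.2] at t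
      have hn' : l ≤ n * l := le_mul_of_one_le_left hl.le (by exact_mod_cast hn)
      push_cast
      rcases le_max_iff.mp f with f | f <;> linarith
  exact (key n).1

theorem dist_zpow_smul {h : H} {o : V} {l : ℤ} (hl : 0 < l) (h1 : d o (h • o) = l)
    (h2 : d o (h • h • o) = 2 * l) {m n : ℤ} (hmn : m ≤ n) :
    d (h ^ m • o) (h ^ n • o) = (n - m) * l := by
  obtain ⟨k, rfl⟩ := Int.le.dest hmn
  rw [zpow_add, mul_smul, hi, zpow_natCast, hd.dist_pow_smul hi hl h1 h2]
  ring

/-- Elements commuting with a hyperbolic `h` move the points of its axis along the axis. -/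
theorem exists_axis_position {h : H} {o : V} {l : ℤ} (hl : 0 < l) (h1 : d o (h • o) = l)
    (h2 : d o (h • h • o) = 2 * l) {k : H} (hk : Commute k h) :
    ∃ z : ℤ, ∀ N : ℤ, d o (k • o) < N →
      d (h ^ (-N) • o) (k • o) = N * l + z ∧ d (k • o) (h ^ N • o) = N * l - z := by
  have hz := fun {m n : ℤ} => hd.dist_zpow_smul hi hl h1 h2 (m := m) (n := n)
  have D0 := hd.nonneg o (k • o)
  have key : ∀ N : ℤ, d o (k • o) < N →
      d (h ^ (-N) • o) (k • o) + d (k • o) (h ^ N • o) = 2 * (N * l) := by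
    intro N hN
    have hNl : N ≤ N * l := le_mul_of_one_le_right (by omega) (by omega)
    have a1 : d (k • h ^ (-N) • o) (k • o) = N * l := by
      rw [hi]; have := hz (m := -N) (n := 0) (by omega); simpa using this
    have a2 : d (k • o) (k • h ^ N • o) = N * l := by
      rw [hi]; have := hz (m := 0) (n := N) (by omega); simpa using this
    have a3 : d (k • h ^ (-N) • o) (k • h ^ N • o) = 2 * (N * l) := by
      rw [hi, hz (by omega)]; ring
    have a4 : d (h ^ (-N) • o) (h ^ N • o) = 2 * (N * l) := by
      rw [hz (by omega)]; ring
    -- An element commuting with h displaces all points h^M • o by the same amount. Once N exceeds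
    -- this amount, the segment from h^(-N) • o to h^N • o and its image under k have nearby ends,
    -- so they share their middle and k • o lies on the first one.
    have a5 : ∀ M : ℤ, d (h ^ M • o) (k • h ^ M • o) = d o (k • o) := by
      intro M
      rw [← mul_smul, (hk.zpow_right M).eq, mul_smul, hi]
    have f1 := hd.four (k • h ^ (-N) • o) (k • h ^ N • o) (h ^ (-N) • o) (k • o)
    have f2 := hd.four (h ^ (-N) • o) (k • h ^ N • o) (h ^ N • o) (k • o)
    have t1 := hd.triangle (h ^ (-N) • o) (k • o) (h ^ N • o)
    have n1 := hd.nonneg (h ^ (-N) • o) (k • o)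
    have n2 := hd.nonneg (k • o) (h ^ N • o)
    have s1 := a5 (-N)
    have s2 := a5 N
    simp only [hd.symm (k • h ^ N • o), hd.symm (k • h ^ (-N) • o) (h ^ (-N) • o),
      hd.symm (h ^ N • o) (k • o)] at *
    omega
  -- The signed position of k • o on the axis, read off at one admissible N. For larger N the
  -- triangle inequality bounds both distances from above, and their known sum forces equality.
  refine ⟨d (h ^ (-(d o (k • o) + 1)) • o) (k • o) - (d o (k • o) + 1) * l, fun N hN => ?_⟩
  set M := d o (k • o) + 1 with hM
  have kM := key M (by omega)
  have kN := key N hN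
  have b1 := hz (m := -N) (n := -M) (by omega)
  have b2 := hz (m := M) (n := N) (by omega)
  have t1 := hd.triangle (h ^ (-N) • o) (h ^ (-M) • o) (k • o)
  have t2 := hd.triangle (k • o) (h ^ M • o) (h ^ N • o)
  constructor <;> linarith

/-- If no nontrivial element commuting with the hyperbolic element `h` fixes the point `o` of its
axis, then the centralizer of `h` is cyclic. -/
theorem isCyclic_centralizer {h : H} {o : V} {l : ℤ} (hl : 0 < l) (h1 : d o (h • o) = l)
    (h2 : d o (h • h • o) = 2 * l) (hfree : ∀ k : H, Commute k h → k • o = o → k = 1) :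
    IsCyclic (Subgroup.centralizer {h}) := by
  have hz := fun {m n : ℤ} => hd.dist_zpow_smul hi hl h1 h2 (m := m) (n := n)
  have hc : ∀ k : Subgroup.centralizer {h}, Commute (k : H) h := fun k =>
    Subgroup.mem_centralizer_singleton_iff.mp k.2
  choose z hzk using fun k : Subgroup.centralizer {h} =>
    hd.exists_axis_position hi hl h1 h2 (hc k)
  -- Positions add up, so they give a homomorphism from the centralizer to ℤ. An element of its
  -- kernel fixes o, hence is trivial.
  have hmul : ∀ k k', z (k * k') = z k + z k' := by
    intro k k'
    have D0 := hd.nonneg o ((k : H) • o)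
    have D1 := hd.nonneg o ((k' : H) • o)
    have D2 := hd.nonneg o (((k * k' : Subgroup.centralizer {h}) : H) • o)
    -- So large that every point below lies well inside the segment, and the unwanted alternative of
    -- the four-point condition fails.
    obtain ⟨N, hN⟩ : ∃ N : ℤ, N = d o ((k : H) • o) + d o ((k' : H) • o) +
      d o (((k * k' : Subgroup.centralizer {h}) : H) • o) + |z (k * k')| + |z k| + |z k'| + 1 :=
      ⟨_, rfl⟩
    have hp1 := abs_nonneg (z (k * k'))
    have hp2 := abs_nonneg (z k)
    have hp3 := abs_nonneg (z k')
    have hp4 := neg_abs_le (z (k * k'))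
    have hp5 := le_abs_self (z k)
    have hp6 := neg_abs_le (z k')
    have hNl : N ≤ N * l := le_mul_of_one_le_right (by omega) (by omega)
    obtain ⟨c1, c2⟩ := hzk (k * k') (2 * N) (by omega)
    set x := h ^ (-(2 * N)) • o with hx
    set y := h ^ (2 * N) • o
    set g := ((k * k' : Subgroup.centralizer {h}) : H) • o with hg
    have hxy : d x y = 4 * (N * l) := by rw [hz (by omega)]; ring
    obtain ⟨c3, -⟩ := hzk k' N (by omega)
    obtain ⟨c4, -⟩ := hzk k N (by omega)
    obtain ⟨-, c5⟩ := hzk k (3 * N) (by omega)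
    -- A point of the axis well to the left of k k' • o. Since p = k h^(-N) • o, its distance to k
    -- k' • o is that of h^(-N) • o to k' • o.
    set p := h ^ (-N) • (k : H) • o with hp
    have e0 : p = (k : H) • h ^ (-N) • o := by
      rw [hp, ← mul_smul, ← mul_smul, ((hc k).zpow_right (-N)).eq]
    have e1 : d p g = N * l + z k' := by
      rw [e0, hg, Subgroup.coe_mul, mul_smul, hi, c3]
    have e2 : d x p = N * l + z k := by
      rw [← c4, ← hi (h ^ (-N)) (h ^ (-N) • o), ← mul_smul, ← zpow_add, hx]
      congr 3; ring
    have e3 : d p y = 3 * (N * l) - z k := by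
      rw [← hi (h ^ N), ← mul_smul, ← mul_smul, ← mul_smul, ← zpow_add, ← mul_assoc, ← zpow_add,
        show N + -N = 0 by ring, show N + 2 * N = 3 * N by ring, zpow_zero, one_mul, c5]
    have f := hd.four p g x y
    have t := hd.triangle x p g
    rw [hd.symm g y, hd.symm g x, hd.symm p x] at f
    rw [hd.symm g y] at c2
    have n1 := hd.nonneg p g
    rw [c1, e2, e1] at t
    rw [c1, c2, e2, e1, e3, hxy] at f
    rcases le_max_iff.mp f with f | f <;> linarith
  let F : Subgroup.centralizer {h} →* Multiplicative ℤ :=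
    { toFun := fun k => Multiplicative.ofAdd (z k)
      map_one' := by
        have := hmul 1 1
        rw [mul_one] at this
        rw [show z 1 = 0 by omega]; rfl
      map_mul' := fun k k' => by rw [hmul]; rfl }
  refine isCyclic_of_injective F ((injective_iff_map_eq_one F).mpr fun k hk => ?_)
  have hk0 : z k = 0 := hk
  refine Subtype.ext (hfree k (hc k) ?_)
  have D0 := hd.nonneg o ((k : H) • o)
  obtain ⟨N, hN⟩ : ∃ N : ℤ, N = d o ((k : H) • o) + 1 := ⟨_, rfl⟩
  obtain ⟨c1, c2⟩ := hzk k N (by omega)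
  have b1 := hz (m := -N) (n := 0) (by omega)
  have b2 := hz (m := 0) (n := N) (by omega)
  have b3 := hz (m := -N) (n := N) (by omega)
  simp only [zpow_zero, one_smul] at b1 b2
  have f := hd.four o ((k : H) • o) (h ^ (-N) • o) (h ^ N • o)
  rw [hd.symm o (h ^ (-N) • o), hd.symm ((k : H) • o) (h ^ (-N) • o), b1, b2, b3, c1, c2, hk0] at f
  refine (hd.eq_of_zero _ _ (le_antisymm ?_ D0)).symm
  rcases le_max_iff.mp f with f | f <;> linarith

end IsTreeDist

end

/-! ### Free groups with a permuted basis -/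

section

namespace FreeGroup

section Supported

variable {α : Type*} [DecidableEq α]

/-- The words of a free group all of whose letters belong to `Y`. -/
def supported (Y : Set α) : Subgroup (FreeGroup α) where
  carrier := {f | ∀ p ∈ f.toWord, p.1 ∈ Y}
  one_mem' := by simp
  mul_mem' {f g} hf hg p hp := by
    rcases List.mem_append.mp ((toWord_mul_sublist f g).subset hp) with h | h
    exacts [hf p h, hg p h]
  inv_mem' {f} hf p hp := by
    rw [toWord_inv, invRev, List.mem_reverse, List.mem_map] at hp
    obtain ⟨q, hq, rfl⟩ := hp
    exact hf q hq

theorem mem_supported {Y : Set α} {f : FreeGroup α} :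
    f ∈ supported Y ↔ ∀ p ∈ f.toWord, p.1 ∈ Y := Iff.rfl

/-- A supported subgroup spans a convex subtree: if p is on the geodesic from f to g, the reduced
word of f⁻¹p is a prefix of that of f⁻¹g. -/
theorem mem_supported_of_between {Y : Set α} {f g p : FreeGroup α} (hf : f ∈ supported Y)
    (hg : g ∈ supported Y) (h : treeDist f p + treeDist p g = treeDist f g) : p ∈ supported Y := by
  have key : (f⁻¹ * g).toWord = (f⁻¹ * p).toWord ++ (p⁻¹ * g).toWord := by
    have hs := toWord_mul_sublist (f⁻¹ * p) (p⁻¹ * g)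
    rw [show f⁻¹ * p * (p⁻¹ * g) = f⁻¹ * g by group] at hs
    refine hs.eq_of_length ?_
    simp only [treeDist, norm] at h
    rw [List.length_append]
    omega
  have hfg : f⁻¹ * g ∈ supported Y := mul_mem (inv_mem hf) hg
  have hfp : f⁻¹ * p ∈ supported Y := fun q hq =>
    hfg q (by rw [key]; exact List.mem_append_left _ hq)
  simpa using mul_mem hf hfp

omit [DecidableEq α] in
theorem mk_singleton_mem_zpowers (x : α) (b : Bool) : mk [(x, b)] ∈ Subgroup.zpowers (of x) := by
  cases b
  · have : mk [(x, false)] = (of x)⁻¹ := by simp [of, inv_mk, invRev]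
    rw [this]
    exact inv_mem (Subgroup.mem_zpowers _)
  · exact Subgroup.mem_zpowers _

theorem mem_zpowers_of_mem_supported {x : α} {f : FreeGroup α} (h : f ∈ supported {x}) :
    f ∈ Subgroup.zpowers (of x) := by
  rw [mem_supported] at h
  rw [← mk_toWord (x := f)]
  revert h
  induction f.toWord with
  | nil => exact fun _ => one_mem _
  | cons p L ih =>
    intro h
    rw [show p :: L = [p] ++ L from rfl, ← mul_mk]
    refine mul_mem ?_ (ih fun q hq => h q (List.mem_cons_of_mem _ hq))
    have := h p List.mem_cons_self
    rcases p with ⟨y, b⟩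
    simp only [Set.mem_singleton_iff] at this
    subst this
    exact mk_singleton_mem_zpowers _ b

theorem mk_singleton_mem_supported {Y : Set α} {p : α × Bool} (h : p.1 ∈ Y) :
    mk [p] ∈ supported Y := by
  intro q hq
  rw [toWord_mk, IsReduced.singleton.reduce_eq, List.mem_singleton] at hq
  rwa [hq]

theorem supported_univ (f : FreeGroup α) : f ∈ supported Set.univ := fun _ _ => trivial

end Supported

section PermAut

variable (A X : Type*) [Group A] [MulAction A X]

/-- The action on a free group by permutations of the basis. -/
def permAut : A →* MulAut (FreeGroup X) where
  toFun a := freeGroupCongr (MulAction.toPerm a)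
  map_one' := by
    refine MulEquiv.toMonoidHom_injective ?_
    ext x
    simp [freeGroupCongr]
  map_mul' a b := by
    refine MulEquiv.toMonoidHom_injective ?_
    ext x
    simp [freeGroupCongr, mul_smul]

variable {A X}

@[simp]
theorem permAut_mk (a : A) (L : List (X × Bool)) :
    permAut A X a (mk L) = mk (L.map fun p => (a • p.1, p.2)) := by
  simp [permAut, freeGroupCongr]

@[simp]
theorem permAut_of (a : A) (x : X) : permAut A X a (of x) = of (a • x) := by
  simp [of]

theorem isReduced_map_smul (a : A) {L : List (X × Bool)} (h : IsReduced L) :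
    IsReduced (L.map fun p => (a • p.1, p.2)) := by
  rw [IsReduced, List.isChain_map]
  refine h.imp fun p q hpq => ?_
  intro e
  exact hpq (MulAction.injective a e)

variable [DecidableEq X]

theorem toWord_permAut (a : A) (f : FreeGroup X) :
    (permAut A X a f).toWord = f.toWord.map fun p => (a • p.1, p.2) := by
  conv_lhs => rw [← mk_toWord (x := f)]
  rw [permAut_mk, toWord_mk, (isReduced_map_smul a isReduced_toWord).reduce_eq]

theorem norm_permAut (a : A) (f : FreeGroup X) : (permAut A X a f).norm = f.norm := by
  rw [norm, toWord_permAut, List.length_map]; rfl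

theorem smul_eq_of_permAut_eq {a : A} {f : FreeGroup X} (h : permAut A X a f = f) :
    ∀ p ∈ f.toWord, a • p.1 = p.1 := by
  have h1 := toWord_permAut a f
  rw [h] at h1
  have h2 : f.toWord.map id = f.toWord.map fun p => (a • p.1, p.2) := by rw [← h1, List.map_id]
  intro p hp
  exact (congrArg Prod.fst (List.map_eq_map_iff.mp h2 p hp)).symm

theorem permAut_mem_supported {Y : Set X} {a : A} (ha : ∀ y ∈ Y, a • y ∈ Y) {f : FreeGroup X}
    (hf : f ∈ supported Y) : permAut A X a f ∈ supported Y := by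
  intro p hp
  rw [toWord_permAut, List.mem_map] at hp
  obtain ⟨q, hq, rfl⟩ := hp
  exact ha _ (hf q hq)

/-- A twisted conjugate of minimal length is twisted cyclically reduced. -/
theorem norm_twisted_sq_or (a : A) (w : FreeGroup X) :
    (w * permAut A X a w).norm = 2 * w.norm ∨
      ∃ p ∈ w.toWord, ((mk [p])⁻¹ * w * permAut A X a (mk [p])).norm < w.norm := by
  by_cases hr : IsReduced (w.toWord ++ (permAut A X a w).toWord)
  · left
    rw [norm, toWord_mul, hr.reduce_eq, List.length_append, two_mul]
    exact congrArg _ (norm_permAut a w)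
  right
  have hr' : ¬ ∀ p ∈ w.toWord.getLast?, ∀ q ∈ (permAut A X a w).toWord.head?,
      p.1 = q.1 → p.2 = q.2 := fun hc =>
    hr (List.isChain_append.mpr ⟨isReduced_toWord, isReduced_toWord, hc⟩)
  push Not at hr'
  obtain ⟨p, hp, q, hq, h1, h2⟩ := hr'
  rw [toWord_permAut] at hq
  obtain ⟨L, hL⟩ : ∃ L, w.toWord = L := ⟨_, rfl⟩
  rw [hL] at hp hq ⊢
  have hn : w.norm = L.length := by rw [norm, hL]
  rcases L with _ | ⟨x, L⟩
  · simp at hp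
  simp only [List.map_cons, List.head?_cons, Option.mem_def, Option.some.injEq] at hq
  subst hq
  -- The last letter of w cancels the image under a of the first letter x, so the twisted conjugate
  -- by x loses both.
  refine ⟨x, List.mem_cons_self, ?_⟩
  rcases List.eq_nil_or_concat L with rfl | ⟨M, y, rfl⟩
  -- In a one-letter word the letter would have to cancel its own image, but the action preserves
  -- exponents.
  · simp only [List.getLast?_singleton, Option.mem_def, Option.some.injEq] at hp
    subst hp
    exact absurd rfl h2
  · rw [List.concat_eq_append] at hp hL hn
    have : y = p := by
      rw [← List.cons_append, List.getLast?_append] at hp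
      simpa using hp
    subst this
    have hw : w = mk [x] * mk M * mk [y] := by
      rw [← mk_toWord (x := w), hL]
      simp only [mul_mk]
      simp
    have hy : mk [y] * permAut A X a (mk [x]) = 1 := by
      rw [permAut_mk]
      rcases x with ⟨x, s⟩
      rcases y with ⟨y, t⟩
      simp only at h1 h2
      subst h1
      have : mk [((a • x), s)] = (mk [((a • x), t)])⁻¹ := by
        rw [inv_mk]
        simp only [invRev, List.map_cons, List.map_nil, List.reverse_singleton]
        congr
        cases s <;> cases t <;> simp_all
      simp only [List.map_cons, List.map_nil]
      rw [this, mul_inv_cancel]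
    have e : (mk [x])⁻¹ * w * permAut A X a (mk [x]) = mk M := by
      rw [hw, show (mk [x])⁻¹ * (mk [x] * mk M * mk [y]) * permAut A X a (mk [x]) =
        mk M * (mk [y] * permAut A X a (mk [x])) by group, hy, mul_one]
    rw [e, hn]
    refine lt_of_le_of_lt norm_mk_le ?_
    simp

end PermAut

end FreeGroup

/-! ### The semidirect product and its action on the tree -/

open FreeGroup in
/-- The semidirect product of the free group on an `A`-set `X` with `A`. -/
abbrev PermFreeProduct (A X : Type*) [Group A] [MulAction A X] :=
  SemidirectProduct (FreeGroup X) A (permAut A X)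

namespace PermFreeProduct

open FreeGroup SemidirectProduct

variable {A X : Type*} [Group A] [MulAction A X]

/-- The action on the vertices of the Cayley tree of the free group. -/
instance : MulAction (PermFreeProduct A X) (FreeGroup X) where
  smul h f := h.left * permAut A X h.right f
  one_smul f := by
    change (1 : PermFreeProduct A X).left * permAut A X (1 : PermFreeProduct A X).right f = f
    simp
  mul_smul h k f := by
    change (h * k).left * permAut A X (h * k).right f =
      h.left * permAut A X h.right (k.left * permAut A X k.right f)
    simp [mul_assoc]

theorem smul_def (h : PermFreeProduct A X) (f : FreeGroup X) :
    h • f = h.left * permAut A X h.right f := rfl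

theorem smul_one_eq (h : PermFreeProduct A X) : h • (1 : FreeGroup X) = h.left := by
  simp [smul_def]

/-- The subgroup of words supported on `Y` times `B`. -/
def supportedSubgroup [DecidableEq X] (Y : Set X) (B : Subgroup A)
    (hY : ∀ b ∈ B, ∀ y ∈ Y, b • y ∈ Y) : Subgroup (PermFreeProduct A X) where
  carrier := {h | h.left ∈ supported Y ∧ h.right ∈ B}
  one_mem' := ⟨one_mem _, one_mem _⟩
  mul_mem' hh hk :=
    ⟨mul_mem hh.1 (permAut_mem_supported (hY _ hh.2) hk.1), mul_mem hh.2 hk.2⟩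
  inv_mem' hh :=
    ⟨permAut_mem_supported (hY _ (inv_mem hh.2)) (inv_mem hh.1), inv_mem hh.2⟩

variable [DecidableEq X]

theorem dist_smul (h : PermFreeProduct A X) (f g : FreeGroup X) :
    treeDist (h • f) (h • g) = treeDist f g := by
  rw [smul_def, smul_def, treeDist_mul_left, treeDist, treeDist, ← _root_.map_inv,
    ← _root_.map_mul, norm_permAut]

/-- Twisted cyclically reduced elements. -/
def IsHyperbolic (h : PermFreeProduct A X) : Prop :=
  h.left ≠ 1 ∧ (h.left * permAut A X h.right h.left).norm = 2 * h.left.norm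

theorem IsHyperbolic.pos {h : PermFreeProduct A X} (hh : IsHyperbolic h) :
    0 < (h.left.norm : ℤ) := by
  have := hh.1
  rw [Ne, ← FreeGroup.norm_eq_zero] at this
  omega

theorem dist_one_smul (h : PermFreeProduct A X) :
    treeDist (1 : FreeGroup X) (h • 1) = (h.left.norm : ℤ) := by
  rw [smul_one_eq, treeDist_one_left]

theorem IsHyperbolic.dist_sq {h : PermFreeProduct A X} (hh : IsHyperbolic h) :
    treeDist (1 : FreeGroup X) (h • h • 1) = 2 * (h.left.norm : ℤ) := by
  rw [smul_one_eq, smul_def, treeDist_one_left, hh.2]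
  push_cast; rfl

theorem IsHyperbolic.pow_ne_one {h : PermFreeProduct A X} (hh : IsHyperbolic h) {n : ℕ}
    (hn : 0 < n) : h ^ n ≠ 1 := by
  intro e
  have := isTreeDist.dist_pow_smul dist_smul hh.pos (dist_one_smul h) hh.dist_sq n
  rw [e, one_smul, treeDist_one_left, FreeGroup.norm_one] at this
  have h2 : 0 < (n : ℤ) * h.left.norm := mul_pos (by exact_mod_cast hn) hh.pos
  simp only [Nat.cast_zero] at this
  omega

/-- The stabilizer of the vertex 1 is A, so freeness on the axis only has to be tested on elements
of A. -/
theorem IsHyperbolic.isCyclic_centralizer {h : PermFreeProduct A X} (hh : IsHyperbolic h)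
    (hfree : ∀ a : A, Commute (inr a) h → a = 1) : IsCyclic (Subgroup.centralizer {h}) := by
  refine isTreeDist.isCyclic_centralizer dist_smul hh.pos (dist_one_smul h) hh.dist_sq
    fun k hk h1 => ?_
  rw [smul_one_eq] at h1
  have e : k = inr k.right := by ext <;> simp [h1]
  rw [e] at hk
  rw [e, hfree _ hk, _root_.map_one]

/-- The centralizer of a hyperbolic element of a supported subgroup maps the letters of that element
and its base point into the support. -/
theorem IsHyperbolic.of_commute {Y : Set X} {B : Subgroup A} {hY : ∀ b ∈ B, ∀ y ∈ Y, b • y ∈ Y}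
    {h k : PermFreeProduct A X} (hh : IsHyperbolic h) (hB : h ∈ supportedSubgroup Y B hY)
    (hk : Commute k h) : k.left ∈ supported Y ∧ ∃ y ∈ Y, k.right • y ∈ Y := by
  -- The vertex k • 1 = k.left lies on the axis, between h^(-N) • 1 and h^N • 1. Those two are
  -- supported, and supported vertices form a convex set.
  have hleft : k.left ∈ supported Y := by
    obtain ⟨z, hz⟩ := isTreeDist.exists_axis_position dist_smul hh.pos (dist_one_smul h) hh.dist_sq hk
    obtain ⟨c1, c2⟩ := hz (treeDist 1 (k • 1) + 1) (by omega)
    have n1 := (isTreeDist (α := X)).nonneg 1 (k • 1)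
    have c3 := isTreeDist.dist_zpow_smul dist_smul hh.pos (dist_one_smul h) hh.dist_sq
      (m := -(treeDist 1 (k • 1) + 1)) (n := treeDist 1 (k • 1) + 1) (by omega)
    rw [← smul_one_eq]
    refine mem_supported_of_between (f := h ^ (-(treeDist 1 (k • 1) + 1)) • 1)
      (g := h ^ (treeDist 1 (k • 1) + 1) • 1) ?_ ?_ (by rw [c1, c2, c3]; ring)
    · rw [smul_one_eq]
      exact (zpow_mem hB _).1
    · rw [smul_one_eq]
      exact (zpow_mem hB _).1
  refine ⟨hleft, ?_⟩
  -- The free-group components of kh = hk express the image of h.left under k.right through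
  -- supported words; any letter of h.left then provides y.
  have e : k.left * permAut A X k.right h.left = h.left * permAut A X h.right k.left :=
    congrArg SemidirectProduct.left hk.eq
  have h1 : permAut A X k.right h.left ∈ supported Y := by
    rw [← inv_mul_cancel_left k.left (permAut A X k.right h.left), e]
    exact mul_mem (inv_mem hleft) (mul_mem hB.1 (permAut_mem_supported (hY _ hB.2) hleft))
  have h2 : h.left.toWord ≠ [] := fun h0 => hh.1 (toWord_eq_nil_iff.mp h0)
  obtain ⟨p, hp⟩ := List.exists_mem_of_ne_nil _ h2
  refine ⟨p.1, hB.1 p hp, h1 (k.right • p.1, p.2) ?_⟩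
  rw [toWord_permAut]
  exact List.mem_map_of_mem hp

/-- Every element is conjugate to a hyperbolic one or into `A`. -/
theorem exists_conj {Y : Set X} {B : Subgroup A} {hY : ∀ b ∈ B, ∀ y ∈ Y, b • y ∈ Y}
    (h : PermFreeProduct A X) (hB : h ∈ supportedSubgroup Y B hY) :
    ∃ g ∈ supportedSubgroup Y B hY,
      (∃ b ∈ B, g * h * g⁻¹ = inr b) ∨ IsHyperbolic (g * h * g⁻¹) := by
  obtain ⟨n, hn⟩ : ∃ n, h.left.norm = n := ⟨_, rfl⟩
  induction n using Nat.strong_induction_on generalizing h with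
  | _ n ih =>
  by_cases hw : h.left = 1
  · refine ⟨1, one_mem _, Or.inl ⟨h.right, hB.2, ?_⟩⟩
    ext <;> simp [hw]
  rcases norm_twisted_sq_or h.right h.left with h1 | ⟨p, hp, h1⟩
  · exact ⟨1, one_mem _, Or.inr (by simpa using ⟨hw, h1⟩)⟩
  -- The shortening conjugator is a letter of h.left itself, so it stays in the supported subgroup.
  · have hm : (inl (mk [p]) : PermFreeProduct A X)⁻¹ ∈ supportedSubgroup Y B hY :=
      inv_mem ⟨mk_singleton_mem_supported (hB.1 p hp), one_mem _⟩
    obtain ⟨g, hg, hg'⟩ := ih _ (by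
        rw [← hn]
        refine lt_of_eq_of_lt (congrArg FreeGroup.norm ?_) h1
        simp [mul_assoc]) _ (mul_mem (mul_mem hm hB) (inv_mem hm)) rfl
    refine ⟨g * (inl (mk [p]))⁻¹, mul_mem hg hm, ?_⟩
    rwa [show g * (inl (mk [p]))⁻¹ * h * (g * (inl (mk [p]))⁻¹)⁻¹ =
      g * ((inl (mk [p]))⁻¹ * h * (inl (mk [p]))⁻¹⁻¹) * g⁻¹ by group]

end PermFreeProduct

end

/-! ### Torsion-free CSA groups -/

section

/-- Torsion-free CSA groups, in terms of commuting elements: commutation is transitive on nontrivial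
elements, and an element commutes with every element that conjugates a nontrivial element into its
own centralizer. -/
structure IsTorsionFreeCSA (G : Type*) [Group G] : Prop where
  trans : ∀ x y z : G, x ≠ 1 → Commute y x → Commute x z → Commute y z
  conj : ∀ x g : G, x ≠ 1 → Commute x (g * x * g⁻¹) → Commute g x
  pow_ne_one : ∀ (x : G) (n : ℕ), 0 < n → x ≠ 1 → x ^ n ≠ 1

theorem IsTorsionFreeCSA.of_injective {G H : Type*} [Group G] [Group H] (hH : IsTorsionFreeCSA H)
    (f : G →* H) (hf : Function.Injective f) : IsTorsionFreeCSA G where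
  trans x y z hx hy hz := by
    have h1 : f x ≠ 1 := fun h => hx (hf (by simpa using h))
    have := hH.trans _ _ _ h1 (hy.map f) (hz.map f)
    exact hf (by simpa using this.eq)
  conj x g hx h := by
    have h1 : f x ≠ 1 := fun h => hx (hf (by simpa using h))
    have := hH.conj (f x) (f g) h1 (by simpa using h.map f)
    exact hf (by simpa using this.eq)
  pow_ne_one x n hn hx h := by
    have h1 : f x ≠ 1 := fun h => hx (hf (by simpa using h))
    exact hH.pow_ne_one _ n hn h1 (by rw [← map_pow, h, map_one])

/-- Zorn puts x in a maximal abelian M. By malnormality M contains everything commuting with x, and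
also every g for which gxg⁻¹ commutes with x. -/
theorem isTorsionFreeCSA_of_isCSAGroup {G : Type*} [Group G] (htf : IsTorsionFreeGroup G)
    (hG : IsCSAGroup G) : IsTorsionFreeCSA G := by
  have key : ∀ x : G, x ≠ 1 → ∃ M : Subgroup G, x ∈ M ∧ (∀ a ∈ M, ∀ b ∈ M, a * b = b * a) ∧
      M.IsMalnormal := by
    intro x hx
    obtain ⟨M, hle, hM⟩ := zorn_le_nonempty₀
      {K : Subgroup G | ∀ a ∈ K, ∀ b ∈ K, a * b = b * a} (fun c hc hchain K hK => by
        refine ⟨sSup c, ?_, fun L hL => le_sSup hL⟩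
        intro a ha b hb
        have hdir : DirectedOn (· ≤ ·) c := hchain.directedOn
        obtain ⟨L, hL, haL⟩ := (Subgroup.mem_sSup_of_directedOn ⟨K, hK⟩ hdir).mp ha
        obtain ⟨L', hL', hbL⟩ := (Subgroup.mem_sSup_of_directedOn ⟨K, hK⟩ hdir).mp hb
        obtain ⟨N, hN, h1, h2⟩ := hdir L hL L' hL'
        exact hc hN a (h1 haL) b (h2 hbL)) (Subgroup.zpowers x) (by
        rintro _ ⟨m, rfl⟩ _ ⟨n, rfl⟩
        exact ((Commute.refl x).zpow_zpow m n).eq)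
    exact ⟨M, hle (Subgroup.mem_zpowers x), hM.prop, hG M hM⟩
  refine ⟨fun x y z hx hy hz => ?_, fun x g hx h => ?_, fun x n hn hx h => ?_⟩
  · obtain ⟨M, hxM, hab, hmal⟩ := key x hx
    have : ∀ y, Commute y x → y ∈ M := fun y hy => by
      by_contra hyM
      refine hx (hmal y hyM x hxM ?_)
      rwa [hy.eq, mul_inv_cancel_right]
    exact hab y (this y hy) z (this z hz.symm)
  · obtain ⟨M, hxM, hab, hmal⟩ := key x hx
    have : ∀ y, Commute y x → y ∈ M := fun y hy => by
      by_contra hyM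
      refine hx (hmal y hyM x hxM ?_)
      rwa [hy.eq, mul_inv_cancel_right]
    have hg : g ∈ M := by
      by_contra hgM
      exact hx (hmal g hgM x hxM (this _ h.symm))
    exact hab g hg x hxM
  · exact htf x hx (isOfFinOrder_iff_pow_eq_one.mpr ⟨n, hn, h⟩)

theorem zpow_ne_one_of_pow_ne_one {G : Type*} [Group G]
    (tf : ∀ (x : G) (n : ℕ), 0 < n → x ≠ 1 → x ^ n ≠ 1) {x : G} (hx : x ≠ 1) {n : ℤ} (hn : n ≠ 0) :
    x ^ n ≠ 1 := by
  intro h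
  refine tf x n.natAbs (by omega) hx ?_
  rcases Int.natAbs_eq n with e | e
  · rwa [e, zpow_natCast] at h
  · rwa [e, zpow_neg, zpow_natCast, inv_eq_one] at h

/-- Conjugation by g preserves the cyclic centralizer ⟨r⟩ of x, so it maps r to r or r⁻¹. An
inversion is ruled out by passing to g². -/
theorem commute_of_isCyclic_centralizer {G : Type*} [Group G]
    (trans : ∀ x y z : G, x ≠ 1 → Commute y x → Commute x z → Commute y z)
    (tf : ∀ (x : G) (n : ℕ), 0 < n → x ≠ 1 → x ^ n ≠ 1) {x g : G} (hx : x ≠ 1)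
    (hc : IsCyclic (Subgroup.centralizer {x})) (h : Commute x (g * x * g⁻¹)) : Commute g x := by
  obtain ⟨⟨r, hr⟩, hgen⟩ := hc
  have hgen' : ∀ y, Commute y x → ∃ n : ℤ, r ^ n = y := fun y hy => by
    obtain ⟨n, hn⟩ := hgen ⟨y, Subgroup.mem_centralizer_singleton_iff.mpr hy⟩
    exact ⟨n, congrArg Subtype.val hn⟩
  have hrx : Commute r x := Subgroup.mem_centralizer_singleton_iff.mp hr
  obtain ⟨m, hm⟩ := hgen' x (Commute.refl x)
  have hr1 : r ≠ 1 := by rintro rfl; exact hx (by rw [← hm, one_zpow])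
  have hcx : g * x * g⁻¹ ≠ 1 := fun e => hx (conj_eq_one_iff.mp e)
  have hcx' : g⁻¹ * x * g ≠ 1 := fun e => hx (by
    have := conj_eq_one_iff (a := g⁻¹) (b := x); rw [inv_inv] at this; exact this.mp e)
  have h' : Commute (g⁻¹ * x * g) x := by
    have := (Commute.conj_iff g⁻¹).mpr h
    rw [inv_inv] at this
    convert this using 1
    group
  obtain ⟨q, hq⟩ := hgen' (g * r * g⁻¹) (trans _ _ _ hcx ((Commute.conj_iff g).mpr hrx) h.symm)
  obtain ⟨q', hq'⟩ := hgen' (g⁻¹ * r * g) (trans _ _ _ hcx' (by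
    have := (Commute.conj_iff g⁻¹).mpr hrx
    rwa [inv_inv] at this) h')
  have hqq : r ^ (q * q' - 1) = 1 := by
    rw [zpow_sub, zpow_one, zpow_mul, hq, conj_zpow, hq']
    group
  have hqq' : q * q' = 1 := by
    by_contra hne
    exact zpow_ne_one_of_pow_ne_one tf hr1 (n := q * q' - 1) (by omega) hqq
  have hgr : Commute g r := by
    rcases Int.eq_one_or_neg_one_of_mul_eq_one hqq' with rfl | rfl
    · rw [zpow_one] at hq
      exact (eq_mul_inv_iff_mul_eq.mp hq).symm
    · by_cases hg2 : g ^ 2 = 1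
      · have : g = 1 := by
          by_contra hg
          exact tf g 2 two_pos hg hg2
        rw [this]
        exact Commute.one_left r
      -- If g inverts r, then g² ≠ 1 commutes with both g and r, so transitivity makes g commute
      -- with r after all.
      · refine trans (g ^ 2) g r hg2 ((Commute.refl g).pow_right 2) ?_
        have e1 : g * r * g⁻¹ = r⁻¹ := by rw [← hq, zpow_neg, zpow_one]
        have e2 : g * r⁻¹ * g⁻¹ = r := by
          have := congrArg (·⁻¹) e1
          simp only [mul_inv_rev, inv_inv] at this
          rw [← mul_assoc] at this
          exact this
        have e3 : g ^ 2 * r * (g ^ 2)⁻¹ = r := by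
          rw [show g ^ 2 * r * (g ^ 2)⁻¹ = g * (g * r * g⁻¹) * g⁻¹ by simp [pow_two, mul_assoc],
          e1, e2]
        exact mul_inv_eq_iff_eq_mul.mp e3
  rw [← hm]
  exact hgr.zpow_right m

/-! ### Centralizer extensions preserve the torsion-free CSA property -/

open FreeGroup hiding map_one map_mul map_inv
open SemidirectProduct PermFreeProduct

/-- The extension of a centralizer `C = C_A(u)` as a semidirect product of the free group on the
cosets of `C` with `A`. -/
abbrev CosetFreeProduct (A : Type*) [Group A] (u : A) :=
  PermFreeProduct A (A ⧸ Subgroup.centralizer {u})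

namespace CosetFreeProduct

variable {A : Type*} [Group A]

/-- The stable letter. -/
def stable (u : A) : CosetFreeProduct A u := inl (of ((1 : A) : A ⧸ Subgroup.centralizer {u}))

theorem smul_coe_eq_iff {u a g g' : A} :
    a • (g : A ⧸ Subgroup.centralizer {u}) = g' ↔ Commute (g'⁻¹ * a * g) u := by
  rw [← QuotientGroup.mk_mul_of_mem g' (one_mem (Subgroup.centralizer {u})), mul_one,
    MulAction.Quotient.smul_coe, eq_comm, QuotientGroup.eq, Subgroup.mem_centralizer_singleton_iff,
    smul_eq_mul, ← mul_assoc]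
  rfl

theorem inr_mul_stable_mul_inv (u g : A) : inr g * stable u * (inr g)⁻¹ =
    inl (of (g : A ⧸ Subgroup.centralizer {u})) := by
  rw [stable, ← map_inv, ← inl_aut, permAut_of, MulAction.Quotient.smul_coe, smul_eq_mul, mul_one]

theorem commute_inr_stable {u c : A} (hc : Commute c u) :
    Commute (inr c : CosetFreeProduct A u) (stable u) := by
  refine mul_inv_eq_iff_eq_mul.mp ?_
  rw [inr_mul_stable_mul_inv, stable]
  congr 2
  rw [QuotientGroup.eq]
  exact Subgroup.mem_centralizer_singleton_iff.mpr (by simpa using hc.inv_left.eq)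

theorem commute_inr_iff {u a : A} {k : CosetFreeProduct A u} :
    Commute k (inr a) ↔ Commute k.right a ∧ permAut A _ a k.left = k.left := by
  constructor
  · intro h
    refine ⟨congrArg SemidirectProduct.right h.eq, ?_⟩
    have := congrArg SemidirectProduct.left h.eq
    simpa using this.symm
  · rintro ⟨h1, h2⟩
    apply SemidirectProduct.ext
    · simp [h2]
    · simpa using h1.eq

theorem coe_eq_coe_one {u b : A} (hb : b ∈ Subgroup.centralizer {u}) :
    (b : A ⧸ Subgroup.centralizer {u}) = ((1 : A) : A ⧸ Subgroup.centralizer {u}) :=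
  (QuotientGroup.eq (s := Subgroup.centralizer {u}) (a := 1) (b := b)).mpr (by simpa using hb) |>.symm

open Classical in
/-- The subgroup `B ⋉ F(B / C)`. -/
noncomputable def cosetSubgroup (u : A) (B : Subgroup A) : Subgroup (CosetFreeProduct A u) :=
  supportedSubgroup {x | ∃ b ∈ B, x = (b : A ⧸ Subgroup.centralizer {u})} B (by
    rintro b hb _ ⟨b', hb', rfl⟩
    exact ⟨b * b', mul_mem hb hb', rfl⟩)

theorem inr_mem_cosetSubgroup {u : A} {B : Subgroup A} {b : A} (hb : b ∈ B) :
    (inr b : CosetFreeProduct A u) ∈ cosetSubgroup u B := ⟨one_mem _, hb⟩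

theorem stable_mem_cosetSubgroup (u : A) (B : Subgroup A) : stable u ∈ cosetSubgroup u B := by
  classical
  refine ⟨fun p hp => ?_, one_mem _⟩
  rw [stable, left_inl, toWord_of, List.mem_singleton] at hp
  exact ⟨1, one_mem _, by rw [hp]⟩

-- Since k.right carries some coset bC to some b'C with b, b' ∈ B, it lies in b'Cb⁻¹, which is
-- inside B because C ≤ B.
open Classical in
theorem mem_cosetSubgroup_of_commute {u : A} {B : Subgroup A} (hB : Subgroup.centralizer {u} ≤ B)
    {h k : CosetFreeProduct A u} (hh : IsHyperbolic h) (hm : h ∈ cosetSubgroup u B) (hk : Commute k h) :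
    k ∈ cosetSubgroup u B := by
  obtain ⟨h1, _, ⟨b, hb, rfl⟩, b', hb', h2⟩ := hh.of_commute hm hk
  refine ⟨h1, ?_⟩
  rw [smul_coe_eq_iff] at h2
  have := hB (Subgroup.mem_centralizer_singleton_iff.mpr h2)
  rwa [Subgroup.mul_mem_cancel_right _ hb, Subgroup.mul_mem_cancel_left _ (inv_mem hb')] at this

open Classical in
/-- An element of `B ⋉ F(B / C)` is conjugate there into `B`, or contains its centralizer. -/
theorem exists_conj_or_centralizer_le {u : A} {B : Subgroup A}
    (hB : Subgroup.centralizer {u} ≤ B) {h : CosetFreeProduct A u} (hm : h ∈ cosetSubgroup u B) :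
    (∃ g ∈ cosetSubgroup u B, ∃ b ∈ B, g * h * g⁻¹ = inr b) ∨ ∀ k, Commute k h → k ∈ cosetSubgroup u B := by
  obtain ⟨g, hg, h1 | h1⟩ := exists_conj h hm
  · exact Or.inl ⟨g, hg, h1⟩
  · refine Or.inr fun k hk => ?_
    have := mem_cosetSubgroup_of_commute hB h1 (mul_mem (mul_mem hg hm) (inv_mem hg))
      ((Commute.conj_iff g).mpr hk)
    have h2 := mul_mem (mul_mem (inv_mem hg) this) hg
    rwa [show g⁻¹ * (g * k * g⁻¹) * g = k by group] at h2

section Torsionfree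

variable (hA : IsTorsionFreeCSA A) {u : A} (hu : u ≠ 1)

/-- For B = C the only basis letter is the coset C, which C fixes: the subgroup is C × ⟨t⟩. -/
theorem mem_cosetSubgroup_centralizer_iff {h : CosetFreeProduct A u} :
    h ∈ cosetSubgroup u (Subgroup.centralizer {u}) ↔ ∃ c, Commute c u ∧ ∃ n : ℤ, h = inr c * stable u ^ n := by
  classical
  constructor
  · rintro ⟨h1, h2⟩
    have hc : Commute h.right u := Subgroup.mem_centralizer_singleton_iff.mp h2
    have h3 : h.left ∈ supported {((1 : A) : A ⧸ Subgroup.centralizer {u})} := by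
      intro p hp
      obtain ⟨b, hb, e⟩ := h1 p hp
      rw [e]
      exact coe_eq_coe_one hb
    obtain ⟨n, hn⟩ := mem_zpowers_of_mem_supported h3
    change _ = h.left at hn
    simp only at hn
    refine ⟨h.right, hc, n, ?_⟩
    rw [((commute_inr_stable hc).zpow_right n).eq, stable, ← map_zpow, hn, inl_left_mul_inr_right]
  · rintro ⟨c, hc, n, rfl⟩
    exact mul_mem (inr_mem_cosetSubgroup (Subgroup.mem_centralizer_singleton_iff.mpr hc))
      (zpow_mem (stable_mem_cosetSubgroup _ _) n)

include hA hu

theorem commute_of_mem_cosetSubgroup_centralizer {h k : CosetFreeProduct A u}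
    (hh : h ∈ cosetSubgroup u (Subgroup.centralizer {u})) (hk : k ∈ cosetSubgroup u (Subgroup.centralizer {u})) :
    Commute h k := by
  obtain ⟨c, hc, n, rfl⟩ := mem_cosetSubgroup_centralizer_iff.mp hh
  obtain ⟨c', hc', n', rfl⟩ := mem_cosetSubgroup_centralizer_iff.mp hk
  have h1 : Commute (inr c : CosetFreeProduct A u) (inr c') :=
    (hA.trans u c c' hu hc hc'.symm).map inr
  exact ((h1.mul_right ((commute_inr_stable hc).zpow_right n'))).mul_left
    (((commute_inr_stable hc').symm.zpow_left n).mul_right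
      (((Commute.refl (stable u)).zpow_zpow n n')))

/-- Each letter gC of k is fixed by a, so g⁻¹ag lies in C together with a; the CSA property puts g
in C. -/
theorem mem_cosetSubgroup_of_commute_inr {a : A} (ha : a ≠ 1) (hau : Commute a u)
    {k : CosetFreeProduct A u} (hk : Commute k (inr a)) :
    k ∈ cosetSubgroup u (Subgroup.centralizer {u}) := by
  classical
  obtain ⟨h1, h2⟩ := commute_inr_iff.mp hk
  refine ⟨fun p hp => ?_, Subgroup.mem_centralizer_singleton_iff.mpr (hA.trans a _ _ ha h1 hau)⟩
  obtain ⟨g, hg⟩ := QuotientGroup.mk_surjective p.1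
  have h3 := smul_eq_of_permAut_eq h2 p hp
  rw [← hg, smul_coe_eq_iff] at h3
  have h4 := hA.conj a g⁻¹ ha (by rw [inv_inv]; exact hA.trans u _ _ hu hau h3.symm)
  refine ⟨g, Subgroup.mem_centralizer_singleton_iff.mpr ?_, hg.symm⟩
  exact hA.trans a _ _ ha (by simpa using h4.inv_left) hau

-- Conjugating by a power of t changes nothing in C × ⟨t⟩, so no conjugation by a letter can shorten
-- the word.
omit hA hu in
open Classical in
theorem left_eq_one_or_isHyperbolic {h : CosetFreeProduct A u}
    (hh : h ∈ cosetSubgroup u (Subgroup.centralizer {u})) : h.left = 1 ∨ IsHyperbolic h := by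
  by_cases h1 : h.left = 1
  · exact Or.inl h1
  refine Or.inr ⟨h1, ?_⟩
  rcases norm_twisted_sq_or h.right h.left with h2 | ⟨p, hp, h2⟩
  · exact h2
  exfalso
  obtain ⟨c, hc, n, e⟩ := mem_cosetSubgroup_centralizer_iff.mp hh
  obtain ⟨b, hb, e1⟩ := hh.1 p hp
  have e2 : p.1 = ((1 : A) : A ⧸ Subgroup.centralizer {u}) := by
    rw [e1]
    exact coe_eq_coe_one hb
  obtain ⟨m, hm⟩ := mk_singleton_mem_zpowers p.1 p.2
  change _ = mk [p] at hm
  rw [e2] at hm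
  rw [((commute_inr_stable hc).zpow_right n).eq, stable, ← map_zpow] at e
  have e3 : h.left = of ((1 : A) : A ⧸ Subgroup.centralizer {u}) ^ n := by
    rw [e, mul_left, left_inl, left_inr, map_one, mul_one]
  have e4 : h.right = c := by
    rw [e, mul_right, right_inl, right_inr, one_mul]
  have e5 : permAut A (A ⧸ Subgroup.centralizer {u}) h.right (mk [p]) = mk [p] := by
    simp only [← hm]
    rw [map_zpow, permAut_of, e4]
    congr 2
    rw [smul_coe_eq_iff]
    simpa using hc
  rw [e5, ← hm, e3, ((Commute.refl _).zpow_zpow m n).inv_left.eq, inv_mul_cancel_right] at h2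
  exact lt_irrefl _ h2

theorem mem_cosetSubgroup_centralizer_of_commute {h k : CosetFreeProduct A u} (h1 : h ≠ 1)
    (hh : h ∈ cosetSubgroup u (Subgroup.centralizer {u})) (hk : Commute k h) :
    k ∈ cosetSubgroup u (Subgroup.centralizer {u}) := by
  classical
  rcases left_eq_one_or_isHyperbolic hh with h2 | h2
  · have e : h = inr h.right := by ext <;> simp [h2]
    have hr : h.right ≠ 1 := by
      intro hr
      rw [hr, map_one] at e
      exact h1 e
    rw [e] at hk
    exact mem_cosetSubgroup_of_commute_inr hA hu hr (Subgroup.mem_centralizer_singleton_iff.mp hh.2) hk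
  · exact mem_cosetSubgroup_of_commute le_rfl h2 hh hk

omit hA hu in
/-- An element commuting with `a ≠ 1` in `A` lies in `A`, unless `a` is conjugate into `C_A(u)`. -/
theorem exists_inr_or_exists_conj {a : A} {k : CosetFreeProduct A u}
    (hk : Commute k (inr a)) : k = inr k.right ∨ ∃ g : A, Commute (g * a * g⁻¹) u := by
  classical
  obtain ⟨h1, h2⟩ := commute_inr_iff.mp hk
  by_cases h3 : k.left = 1
  · left
    ext <;> simp [h3]
  · right
    obtain ⟨p, hp⟩ := List.exists_mem_of_ne_nil _ (fun h0 => h3 (toWord_eq_nil_iff.mp h0))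
    obtain ⟨g, hg⟩ := QuotientGroup.mk_surjective p.1
    have h3 := smul_eq_of_permAut_eq h2 p hp
    rw [← hg, smul_coe_eq_iff] at h3
    exact ⟨g⁻¹, by rwa [inv_inv]⟩

/-- The conjugacy classification behind the CSA property: the centralizer lies in A, or the element
lies in the abelian group C × ⟨t⟩, or the centralizer is cyclic. -/
theorem exists_conj_trichotomy (h : CosetFreeProduct A u) :
    ∃ g : CosetFreeProduct A u,
      (∃ a, g * h * g⁻¹ = inr a ∧ ∀ k, Commute k (g * h * g⁻¹) → k = inr k.right) ∨
      g * h * g⁻¹ ∈ cosetSubgroup u (Subgroup.centralizer {u}) ∨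
      (IsCyclic (Subgroup.centralizer {g * h * g⁻¹}) ∧ ∀ n : ℕ, 0 < n → (g * h * g⁻¹) ^ n ≠ 1) := by
  classical
  have conj : ∀ (g : A) (k : CosetFreeProduct A u), inr g * k * (inr g)⁻¹ ∈
      cosetSubgroup u (Subgroup.centralizer {u}) → ∃ g', g' * k * g'⁻¹ ∈
      cosetSubgroup u (Subgroup.centralizer {u}) := fun g k hk => ⟨_, hk⟩
  obtain ⟨g, -, ⟨a, -, h1⟩ | h1⟩ := exists_conj (Y := Set.univ) (B := ⊤)
    (hY := fun _ _ _ _ => trivial) h ⟨supported_univ _, trivial⟩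
  · by_cases hg : ∃ g' : A, Commute (g' * a * g'⁻¹) u
    · obtain ⟨g', hg'⟩ := hg
      refine ⟨inr g' * g, Or.inr (Or.inl ?_)⟩
      rw [show inr g' * g * h * (inr g' * g)⁻¹ = inr g' * (g * h * g⁻¹) * (inr g')⁻¹ by group, h1,
        ← map_inv, ← map_mul, ← map_mul]
      exact inr_mem_cosetSubgroup (Subgroup.mem_centralizer_singleton_iff.mpr hg')
    · refine ⟨g, Or.inl ⟨a, h1, fun k hk => ?_⟩⟩
      rw [h1] at hk
      exact (exists_inr_or_exists_conj hk).resolve_right hg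
  -- A hyperbolic element commuting with some b ≠ 1 in A forces b to be conjugate into C, and the
  -- element then moves into C × ⟨t⟩. Otherwise its centralizer acts freely on the base point.
  · by_cases hb : ∃ b : A, b ≠ 1 ∧ Commute (inr b) (g * h * g⁻¹)
    · obtain ⟨b, hb1, hb⟩ := hb
      rcases exists_inr_or_exists_conj hb.symm with h2 | ⟨g', hg'⟩
      · exact absurd (by rw [h2]; simp) h1.1
      · refine ⟨inr g' * g, Or.inr (Or.inl ?_)⟩
        rw [show inr g' * g * h * (inr g' * g)⁻¹ = inr g' * (g * h * g⁻¹) * (inr g')⁻¹ by group]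
        refine mem_cosetSubgroup_of_commute_inr hA hu (a := g' * b * g'⁻¹)
          (fun e => hb1 (conj_eq_one_iff.mp e)) hg' ?_
        rw [map_mul, map_mul, map_inv]
        exact (Commute.conj_iff _).mpr hb.symm
    · push Not at hb
      refine ⟨g, Or.inr (Or.inr ⟨h1.isCyclic_centralizer fun a ha => ?_, fun n hn =>
        h1.pow_ne_one hn⟩)⟩
      by_contra hne
      exact hb a hne ha

/-- Extensions of centralizers of torsion-free CSA groups are torsion-free CSA. -/
theorem isTorsionFreeCSA : IsTorsionFreeCSA (CosetFreeProduct A u) := by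
  classical
  have trans : ∀ x y z : CosetFreeProduct A u, x ≠ 1 → Commute y x → Commute x z →
      Commute y z := by
    intro x y z hx hy hz
    obtain ⟨g, h⟩ := exists_conj_trichotomy hA hu x
    rw [← Commute.conj_iff g] at hy hz ⊢
    have hx' : g * x * g⁻¹ ≠ 1 := fun e => hx (conj_eq_one_iff.mp e)
    generalize g * x * g⁻¹ = x at *
    generalize g * y * g⁻¹ = y at *
    generalize g * z * g⁻¹ = z at *
    rcases h with ⟨a, rfl, h⟩ | h | ⟨h, -⟩
    · have ha : a ≠ 1 := by rintro rfl; simp at hx'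
      rw [h y hy, h z hz.symm] at *
      exact (hA.trans a _ _ ha (congrArg SemidirectProduct.right hy.eq)
        (congrArg SemidirectProduct.right hz.eq)).map inr
    · exact commute_of_mem_cosetSubgroup_centralizer hA hu
        (mem_cosetSubgroup_centralizer_of_commute hA hu hx' h hy)
        (mem_cosetSubgroup_centralizer_of_commute hA hu hx' h hz.symm)
    · let _ := h.commGroup
      have := mul_comm (⟨y, Subgroup.mem_centralizer_singleton_iff.mpr hy⟩ :
        Subgroup.centralizer {x}) ⟨z, Subgroup.mem_centralizer_singleton_iff.mpr hz.symm⟩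
      exact congrArg Subtype.val this
  have tf : ∀ (x : CosetFreeProduct A u) (n : ℕ), 0 < n → x ≠ 1 → x ^ n ≠ 1 := by
    intro x n hn hx hxn
    have inr_case : ∀ a : A, (inr a : CosetFreeProduct A u) ≠ 1 →
        (inr a : CosetFreeProduct A u) ^ n ≠ 1 := by
      intro a ha e
      rw [← map_pow, ← map_one (inr : A →* CosetFreeProduct A u)] at e
      exact hA.pow_ne_one a n hn (fun e' => ha (by rw [e', map_one])) (inr_injective e)
    obtain ⟨g, h⟩ := exists_conj_trichotomy hA hu x
    have hx' : g * x * g⁻¹ ≠ 1 := fun e => hx (conj_eq_one_iff.mp e)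
    have hxn' : (g * x * g⁻¹) ^ n = 1 := by rw [conj_pow, hxn]; group
    generalize g * x * g⁻¹ = x at *
    rcases h with ⟨a, rfl, h⟩ | h | ⟨-, h⟩
    · exact inr_case a hx' hxn'
    · rcases left_eq_one_or_isHyperbolic h with h2 | h2
      · have e : x = inr x.right := by ext <;> simp [h2]
        rw [e] at hx' hxn'
        exact inr_case _ hx' hxn'
      · exact h2.pow_ne_one hn hxn'
    · exact h n hn hxn'
  refine ⟨trans, fun x k hx hk => ?_, tf⟩
  obtain ⟨g, h⟩ := exists_conj_trichotomy hA hu x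
  have hk' : Commute (g * x * g⁻¹) (g * k * g⁻¹ * (g * x * g⁻¹) * (g * k * g⁻¹)⁻¹) := by
    have := (Commute.conj_iff g).mpr hk
    rwa [show g * (k * x * k⁻¹) * g⁻¹ = g * k * g⁻¹ * (g * x * g⁻¹) * (g * k * g⁻¹)⁻¹ by group]
      at this
  rw [← Commute.conj_iff g]
  have hx' : g * x * g⁻¹ ≠ 1 := fun e => hx (conj_eq_one_iff.mp e)
  generalize g * x * g⁻¹ = x at *
  generalize g * k * g⁻¹ = k at *
  clear hk hx
  rcases h with ⟨a, rfl, h⟩ | h | ⟨h, -⟩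
  · have ha : a ≠ 1 := by rintro rfl; simp at hx'
    have h1 := h _ hk'.symm
    have h2 : Commute a (k.right * a * k.right⁻¹) := by
      have := congrArg SemidirectProduct.right hk'.eq
      rw [commute_iff_eq]
      simpa [mul_assoc] using this
    have h3 := hA.conj a _ ha h2
    have h4 : k * inr a * k⁻¹ = inr a := by
      rw [h1]
      congr 1
      simp only [mul_right, right_inr, inv_right]
      rw [h3.eq, mul_inv_cancel_right]
    exact mul_inv_eq_iff_eq_mul.mp h4
  -- By transitivity x may be replaced by u. Then k u k⁻¹ commutes with u, so it is c tⁿ; the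
  -- projection to A gives c = u, and the exponent sum in t gives n = 0.
  · have hxu : Commute x (inr u) := commute_of_mem_cosetSubgroup_centralizer hA hu h
      (inr_mem_cosetSubgroup (Subgroup.mem_centralizer_singleton_iff.mpr rfl))
    have hu' : (inr u : CosetFreeProduct A u) ≠ 1 := fun e => hu (inr_injective (by simpa using e))
    have hxk : k * x * k⁻¹ ≠ 1 := fun e => hx' (conj_eq_one_iff.mp e)
    have h1 : Commute (k * x * k⁻¹) (inr u) := trans x _ _ hx' hk'.symm hxu
    have h2 : Commute (k * inr u * k⁻¹) (inr u) :=
      trans _ _ _ hxk ((Commute.conj_iff k).mpr hxu.symm) h1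
    have h3 := mem_cosetSubgroup_centralizer_of_commute hA hu hu'
      (inr_mem_cosetSubgroup (Subgroup.mem_centralizer_singleton_iff.mpr rfl)) h2
    obtain ⟨c, hc, n, e⟩ := mem_cosetSubgroup_centralizer_iff.mp h3
    have h4 : Commute k.right u := hA.conj u _ hu
      (by rw [commute_iff_eq]; simpa [mul_assoc] using (congrArg SemidirectProduct.right h2.eq).symm)
    have h5 : c = u := by
      have := congrArg SemidirectProduct.right e
      rw [stable, ← map_zpow] at this
      simp only [mul_right, right_inr, inv_right, right_inl, mul_one] at this
      rw [h4.eq, mul_inv_cancel_right] at this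
      exact this.symm
    let σ : CosetFreeProduct A u →* Multiplicative ℤ :=
      SemidirectProduct.lift (FreeGroup.lift fun _ => Multiplicative.ofAdd 1) 1 (by
        intro a
        ext x
        simp)
    have h6 : σ (stable u) = Multiplicative.ofAdd 1 := by simp [σ, stable]
    have h7 : n = 0 := by
      have := congrArg σ e
      rw [map_mul, map_mul, map_inv, map_mul, map_zpow, h6, mul_right_comm, mul_inv_cancel,
        one_mul] at this
      simp only [σ, lift_inr, MonoidHom.one_apply, one_mul, ← ofAdd_zsmul, smul_eq_mul,
        mul_one] at this
      exact (ofAdd_eq_one.mp this.symm)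
    rw [h5, h7, zpow_zero, mul_one] at e
    have h8 : Commute k (inr u) := mul_inv_eq_iff_eq_mul.mp e
    exact trans _ _ _ hu' h8 hxu.symm
  · exact commute_of_isCyclic_centralizer trans tf hx' h hk'

end Torsionfree

end CosetFreeProduct

end

/-! ### The universal property of centralizer extensions -/

section

theorem Subgroup.mem_centralizer_iff_commute {G : Type*} [Group G] {c v : G} :
    c ∈ Subgroup.centralizer {v} ↔ Commute c v := Subgroup.mem_centralizer_singleton_iff

namespace CosetFreeProduct

open FreeGroup hiding map_one map_mul map_inv
open SemidirectProduct PermFreeProduct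

variable {A : Type*} [Group A] {u : A} {T : Type*} [Group T]

/-- The universal property of the extension of a centralizer. -/
def lift (α : A →* T) (τ : T) (h : ∀ c, Commute c u → Commute (α c) τ) :
    CosetFreeProduct A u →* T :=
  SemidirectProduct.lift
    (FreeGroup.lift fun x => Quotient.liftOn' x (fun a => α a * τ * (α a)⁻¹) (by
      intro a b hab
      rw [QuotientGroup.leftRel_apply, Subgroup.mem_centralizer_iff_commute] at hab
      have h1 : α (a⁻¹ * b) * τ * (α (a⁻¹ * b))⁻¹ = τ := by
        rw [(h _ hab).eq, mul_inv_cancel_right]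
      simp only [map_mul, map_inv] at h1
      change α a * τ * (α a)⁻¹ = α b * τ * (α b)⁻¹
      conv_lhs => rw [← h1]
      group))
    α (by
      intro a
      ext x
      obtain ⟨b, rfl⟩ := QuotientGroup.mk_surjective x
      simp only [MonoidHom.comp_apply, MulEquiv.coe_toMonoidHom, permAut_of, FreeGroup.lift_apply_of,
        MulAction.Quotient.smul_coe, MulAut.conj_apply]
      change α (a • b) * τ * (α (a • b))⁻¹ = α a * (α b * τ * (α b)⁻¹) * (α a)⁻¹
      simp [mul_assoc])

@[simp]
theorem lift_inr {α : A →* T} {τ : T} {h : ∀ c, Commute c u → Commute (α c) τ} (a : A) :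
    lift α τ h (inr a) = α a := SemidirectProduct.lift_inr ..

@[simp]
theorem lift_stable {α : A →* T} {τ : T} {h : ∀ c, Commute c u → Commute (α c) τ} :
    lift α τ h (stable u) = τ := by
  rw [lift, stable, SemidirectProduct.lift_inl, FreeGroup.lift_apply_of]
  change α 1 * τ * (α 1)⁻¹ = τ
  simp

theorem hom_ext {f g : CosetFreeProduct A u →* T} (h : ∀ a, f (inr a) = g (inr a))
    (hs : f (stable u) = g (stable u)) : f = g := by
  refine SemidirectProduct.hom_ext ?_ (MonoidHom.ext h)
  ext x
  obtain ⟨b, rfl⟩ := QuotientGroup.mk_surjective x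
  simp only [MonoidHom.comp_apply, ← inr_mul_stable_mul_inv, map_mul, map_inv, h, hs]

theorem cosetSubgroup_le {B : Subgroup A} {P : Subgroup (CosetFreeProduct A u)}
    (h : ∀ b ∈ B, inr b ∈ P) (hs : stable u ∈ P) : cosetSubgroup u B ≤ P := by
  classical
  rintro y ⟨h1, h2⟩
  rw [← inl_left_mul_inr_right y]
  refine mul_mem ?_ (h _ h2)
  rw [mem_supported] at h1
  rw [← FreeGroup.mk_toWord (x := y.left)]
  revert h1
  induction y.left.toWord with
  | nil => exact fun _ => one_mem _
  | cons p L ih =>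
    intro h1
    rw [show p :: L = [p] ++ L from rfl, ← FreeGroup.mul_mk, map_mul]
    refine mul_mem ?_ (ih fun q hq => h1 q (List.mem_cons_of_mem _ hq))
    obtain ⟨b, hb, e⟩ := h1 p List.mem_cons_self
    obtain ⟨n, hn⟩ := mk_singleton_mem_zpowers p.1 p.2
    change _ = FreeGroup.mk [p] at hn
    simp only at hn
    rw [← hn, map_zpow, e, ← inr_mul_stable_mul_inv]
    exact zpow_mem (mul_mem (mul_mem (h b hb) hs) (inv_mem (h b hb))) n

theorem stable_mul_inr (a : Subgroup.centralizer {u}) :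
    stable u * inr (a : A) =
      inr ((MulEquiv.refl (Subgroup.centralizer {u}) a : _) : A) * stable u :=
  (commute_inr_stable (Subgroup.mem_centralizer_iff_commute.mp a.2)).symm.eq

theorem commute_of_t {c : A} (hc : Commute c u) :
    Commute (HNNExtension.of c : CentralizerExtension A u) HNNExtension.t :=
  (HNNExtension.t_mul_of (φ := MulEquiv.refl (Subgroup.centralizer {u}))
    ⟨c, Subgroup.mem_centralizer_iff_commute.mpr hc⟩).symm

/-- The presentation of the extension of a centralizer as a semidirect product. -/
def equivCentralizerExtension (u : A) : CentralizerExtension A u ≃* CosetFreeProduct A u :=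
  MonoidHom.toMulEquiv
    (HNNExtension.lift inr (stable u) stable_mul_inr)
    (lift HNNExtension.of HNNExtension.t fun _ => commute_of_t)
    (by
      refine HNNExtension.hom_ext ?_ ?_
      · ext a
        simp
      · simp)
    (by refine hom_ext (fun a => ?_) ?_ <;> simp)

@[simp]
theorem equivCentralizerExtension_of (u a : A) :
    equivCentralizerExtension u (HNNExtension.of a) = inr a := by
  simp [equivCentralizerExtension, MonoidHom.toMulEquiv]

end CosetFreeProduct

/-! ### Single centralizer extensions inside an ambient group -/

variable {Γ : Type u} [Group Γ]

/-- `L` is the extension of the centralizer of `v ∈ K`, with stable letter `s`. -/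
structure IsCE (K L : Subgroup Γ) (v s : Γ) : Prop where
  mem : v ∈ K
  ne : v ≠ 1
  sup : L = K ⊔ Subgroup.zpowers s
  comm : ∀ c ∈ K, Commute c v → Commute c s
  lift : ∀ (T : Type u) [Group T] (α : K →* T) (τ : T),
    (∀ c : K, Commute (c : Γ) v → Commute (α c) τ) →
      ∃ γ : L →* T, (∀ k (hk : k ∈ K) (hk' : k ∈ L), γ ⟨k, hk'⟩ = α ⟨k, hk⟩) ∧
        ∀ hs : s ∈ L, γ ⟨s, hs⟩ = τ

/-- The subgroup ⟨G, s⟩ is the image of G ⋉ F(G/C), with C = C_K(v), so the dichotomy for such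
subgroups carries over along f. -/
theorem CosetFreeProduct.conj_mem_or_centralizer_le {K G : Subgroup Γ} {v : K} {s : Γ}
    {f : CosetFreeProduct K v →* Γ} (hfi : Function.Injective f)
    (f1 : ∀ k : K, f (SemidirectProduct.inr k) = k) (f2 : f (stable v) = s) (hG : G ≤ K)
    (hC : ∀ x ∈ K, Commute x (v : Γ) → x ∈ G) {w : Γ} (hw : w ∈ G ⊔ Subgroup.zpowers s) :
    (∃ g ∈ G ⊔ Subgroup.zpowers s, g * w * g⁻¹ ∈ G) ∨
      ∀ k, Commute (f k) w → f k ∈ G ⊔ Subgroup.zpowers s := by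
  have hle : CosetFreeProduct.cosetSubgroup v (G.subgroupOf K) ≤ (G ⊔ Subgroup.zpowers s).comap f := by
    refine CosetFreeProduct.cosetSubgroup_le (fun b hb => ?_) ?_
    · rw [Subgroup.mem_comap, f1]
      exact Subgroup.mem_sup_left (Subgroup.mem_subgroupOf.mp hb)
    · rw [Subgroup.mem_comap, f2]
      exact Subgroup.mem_sup_right (Subgroup.mem_zpowers _)
  have hge : G ⊔ Subgroup.zpowers s ≤
      (CosetFreeProduct.cosetSubgroup v (G.subgroupOf K)).map f := by
    refine sup_le (fun g hg => ?_) ((Subgroup.zpowers_le).mpr ?_)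
    · have h1 : (SemidirectProduct.inr ⟨g, hG hg⟩ : CosetFreeProduct K v) ∈
          CosetFreeProduct.cosetSubgroup v (G.subgroupOf K) :=
        CosetFreeProduct.inr_mem_cosetSubgroup (Subgroup.mem_subgroupOf.mpr hg)
      have h2 := Subgroup.mem_map_of_mem f h1
      rwa [f1] at h2
    · have h2 := Subgroup.mem_map_of_mem f
        (CosetFreeProduct.stable_mem_cosetSubgroup v (G.subgroupOf K))
      rwa [f2] at h2
  have hcen : Subgroup.centralizer {v} ≤ G.subgroupOf K := fun x hx =>
    Subgroup.mem_subgroupOf.mpr (hC x x.2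
      (congrArg Subtype.val (Subgroup.mem_centralizer_iff_commute.mp hx).eq))
  obtain ⟨y, hy, rfl⟩ := Subgroup.mem_map.mp (hge hw)
  rcases CosetFreeProduct.exists_conj_or_centralizer_le hcen hy with ⟨g, hg, b, hb, e1⟩ | h3
  · refine Or.inl ⟨f g, Subgroup.mem_comap.mp (hle hg), ?_⟩
    rw [← map_inv, ← map_mul, ← map_mul, e1, f1]
    exact Subgroup.mem_subgroupOf.mp hb
  · exact Or.inr fun k hxw => Subgroup.mem_comap.mp
      (hle (h3 k (hfi (by rw [map_mul, map_mul]; exact hxw.eq))))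

namespace IsCE

open CosetFreeProduct SemidirectProduct

variable {K L M : Subgroup Γ} {v s : Γ}

theorem le (h : IsCE K L v s) : K ≤ L := h.sup ▸ le_sup_left

theorem letter_mem (h : IsCE K L v s) : s ∈ L := by
  rw [h.sup]; exact Subgroup.mem_sup_right (Subgroup.mem_zpowers s)

theorem le_of_mem (h : IsCE K L v s) (hK : K ≤ M) (hs : s ∈ M) : L ≤ M := by
  rw [h.sup]; exact sup_le hK ((Subgroup.zpowers_le).mpr hs)

theorem commute_letter (h : IsCE K L v s) : Commute v s := h.comm v h.mem (Commute.refl v)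

theorem hom_ext (h : IsCE K L v s) {T : Type*} [Group T] {f g : L →* T}
    (hK : ∀ k (hk : k ∈ K), f ⟨k, h.le hk⟩ = g ⟨k, h.le hk⟩)
    (hs : f ⟨s, h.letter_mem⟩ = g ⟨s, h.letter_mem⟩) : f = g := by
  have : L ≤ (f.eqLocus g).map L.subtype :=
    h.le_of_mem (fun k hk => ⟨⟨k, h.le hk⟩, hK k hk, rfl⟩) ⟨⟨s, h.letter_mem⟩, hs, rfl⟩
  ext ⟨x, hx⟩
  obtain ⟨y, hy, e⟩ := this hx
  have : y = ⟨x, hx⟩ := Subtype.ext e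
  rw [← this]
  exact hy

theorem exists_equiv (h : IsCE K L v s) :
    ∃ e : CosetFreeProduct K ⟨v, h.mem⟩ ≃* L,
      (∀ k : K, (e (inr k) : Γ) = k) ∧ (e (stable _) : Γ) = s := by
  have hc : ∀ c : K, Commute (c : Γ) v ↔ Commute c (⟨v, h.mem⟩ : K) := fun c => by
    rw [commute_iff_eq, commute_iff_eq, Subtype.ext_iff]; rfl
  obtain ⟨γ, h1, h2⟩ := h.lift (CosetFreeProduct K ⟨v, h.mem⟩) inr (stable _)
    (fun c hcv => commute_inr_stable ((hc c).mp hcv))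
  let δ : CosetFreeProduct K ⟨v, h.mem⟩ →* L :=
    CosetFreeProduct.lift (Subgroup.inclusion h.le) ⟨s, h.letter_mem⟩ (fun c hcv =>
      Subtype.ext (h.comm c c.2 ((hc c).mpr hcv)).eq)
  have hδ : ∀ k, δ (inr k) = Subgroup.inclusion h.le k := fun k => CosetFreeProduct.lift_inr k
  have hδs : δ (stable _) = ⟨s, h.letter_mem⟩ := CosetFreeProduct.lift_stable
  refine ⟨MonoidHom.toMulEquiv δ γ ?_ ?_, fun k => ?_, ?_⟩
  · refine CosetFreeProduct.hom_ext (fun a => ?_) ?_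
    · rw [MonoidHom.comp_apply, hδ]
      exact h1 _ a.2 _
    · rw [MonoidHom.comp_apply, hδs]
      exact h2 _
  · refine h.hom_ext (fun k hk => ?_) ?_
    · rw [MonoidHom.comp_apply, h1 k hk, hδ]; rfl
    · rw [MonoidHom.comp_apply, h2, hδs]; rfl
  · exact congrArg Subtype.val (hδ k)
  · exact congrArg Subtype.val hδs

theorem exists_retraction (h : IsCE K L v s) :
    ∃ r : L →* K, (∀ k (hk : k ∈ K), r ⟨k, h.le hk⟩ = ⟨k, hk⟩) ∧ r ⟨s, h.letter_mem⟩ = 1 := by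
  obtain ⟨r, h1, h2⟩ := h.lift K (MonoidHom.id K) 1 (fun c _ => Commute.one_right _)
  exact ⟨r, fun k hk => h1 k hk _, h2 _⟩

theorem exists_height (h : IsCE K L v s) :
    ∃ f : L →* Multiplicative ℤ, (∀ k (hk : k ∈ K), f ⟨k, h.le hk⟩ = 1) ∧
      f ⟨s, h.letter_mem⟩ = Multiplicative.ofAdd 1 := by
  -- The exponent sum of s. The universal property tests only groups in `Type u`, hence the lift of
  -- ℤ.
  obtain ⟨f, h1, h2⟩ := h.lift (ULift.{u} (Multiplicative ℤ)) 1 ⟨Multiplicative.ofAdd 1⟩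
    (fun c _ => Commute.one_left _)
  refine ⟨MulEquiv.ulift.toMonoidHom.comp f, fun k hk => ?_, ?_⟩
  · rw [MonoidHom.comp_apply, h1 k hk]; rfl
  · rw [MonoidHom.comp_apply, h2]; rfl

theorem letter_notMem (h : IsCE K L v s) : s ∉ K := by
  intro hs
  obtain ⟨f, h1, h2⟩ := h.exists_height
  rw [h1 s hs] at h2
  exact absurd h2 (by decide)

theorem conj (h : IsCE K L v s) {g : Γ} (hg : g ∈ K) :
    IsCE K L (g * v * g⁻¹) (g * s * g⁻¹) where
  mem := mul_mem (mul_mem hg h.mem) (inv_mem hg)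
  ne e := h.ne (conj_eq_one_iff.mp e)
  sup := by
    have hs : g * s * g⁻¹ ∈ K ⊔ Subgroup.zpowers (g * s * g⁻¹) :=
      Subgroup.mem_sup_right (Subgroup.mem_zpowers _)
    have hg' : g ∈ K ⊔ Subgroup.zpowers (g * s * g⁻¹) := Subgroup.mem_sup_left hg
    refine le_antisymm (h.le_of_mem le_sup_left ?_) (sup_le h.le ((Subgroup.zpowers_le).mpr ?_))
    · have := mul_mem (mul_mem (inv_mem hg') hs) hg'
      rwa [show g⁻¹ * (g * s * g⁻¹) * g = s by group] at this
    · exact mul_mem (mul_mem (h.le hg) h.letter_mem) (inv_mem (h.le hg))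
  comm c hc hcv := by
    rw [← Commute.conj_iff g⁻¹] at hcv ⊢
    rw [show g⁻¹ * (g * v * g⁻¹) * g⁻¹⁻¹ = v by group] at hcv
    rw [show g⁻¹ * (g * s * g⁻¹) * g⁻¹⁻¹ = s by group]
    refine h.comm _ ?_ hcv
    exact mul_mem (mul_mem (inv_mem hg) hc) (inv_mem (inv_mem hg))
  lift T _ α τ hτ := by
    obtain ⟨γ, h1, h2⟩ := h.lift T α ((α ⟨g, hg⟩)⁻¹ * τ * α ⟨g, hg⟩) (fun c hc => by
      have := hτ (⟨g, hg⟩ * c * ⟨g, hg⟩⁻¹) ((Commute.conj_iff g).mpr hc)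
      rw [← Commute.conj_iff (α ⟨g, hg⟩)]
      rw [map_mul, map_mul, map_inv] at this
      rwa [show α ⟨g, hg⟩ * ((α ⟨g, hg⟩)⁻¹ * τ * α ⟨g, hg⟩) * (α ⟨g, hg⟩)⁻¹ = τ by group])
    refine ⟨γ, h1, fun hs => ?_⟩
    have : (⟨g * s * g⁻¹, hs⟩ : L) = ⟨g, h.le hg⟩ * ⟨s, h.letter_mem⟩ * ⟨g, h.le hg⟩⁻¹ := rfl
    rw [this, map_mul, map_mul, map_inv, h2, h1 g hg]
    group

theorem inv (h : IsCE K L v s) : IsCE K L v s⁻¹ where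
  mem := h.mem
  ne := h.ne
  sup := by rw [Subgroup.zpowers_inv, h.sup]
  comm c hc hcv := (h.comm c hc hcv).inv_right
  lift T _ α τ hτ := by
    obtain ⟨γ, h1, h2⟩ := h.lift T α τ⁻¹ (fun c hc => (hτ c hc).inv_right)
    refine ⟨γ, h1, fun hs => ?_⟩
    have : (⟨s⁻¹, hs⟩ : L) = ⟨s, h.letter_mem⟩⁻¹ := rfl
    rw [this, map_inv, h2, inv_inv]

/-- Killing the first letter gives a retraction onto the subextension. -/
theorem sup_zpowers {w z : Γ} (h : IsCE K L w z) (h' : IsCE L M v s) (hv : v ∈ K) :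
    IsCE K (K ⊔ Subgroup.zpowers s) v s where
  mem := hv
  ne := h'.ne
  sup := rfl
  comm c hc := h'.comm c (h.le hc)
  lift T _ α τ hτ := by
    obtain ⟨r, hr, -⟩ := h.exists_retraction
    obtain ⟨γ, h1, h2⟩ := h'.lift T (α.comp r) τ (fun c hc => hτ _ (by
      have : Commute c ⟨v, h.le hv⟩ := Subtype.ext hc.eq
      have := this.map r
      rw [hr v hv] at this
      exact congrArg Subtype.val this.eq))
    have hle : K ⊔ Subgroup.zpowers s ≤ M :=
      sup_le (h.le.trans h'.le) ((Subgroup.zpowers_le).mpr h'.letter_mem)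
    refine ⟨γ.comp (Subgroup.inclusion hle), fun k hk hk' => ?_, fun hs => h2 _⟩
    change γ ⟨k, _⟩ = _
    rw [h1 k (h.le hk), MonoidHom.comp_apply, hr k hk]

theorem mem_or_exists_conj (h : IsCE K L v s) {g x : Γ} (hg : g ∈ K) (hx : x ∈ L)
    (hxg : Commute x g) : x ∈ K ∨ ∃ b ∈ K, Commute (b * g * b⁻¹) v := by
  obtain ⟨e, h1, -⟩ := h.exists_equiv
  obtain ⟨y, hy⟩ := e.surjective ⟨x, hx⟩
  have hc : Commute y (inr ⟨g, hg⟩) := by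
    refine e.injective (Subtype.ext ?_)
    rw [map_mul, map_mul, hy, Subgroup.coe_mul, Subgroup.coe_mul, h1]
    exact hxg.eq
  rcases exists_inr_or_exists_conj hc with h2 | ⟨b, hb⟩
  · left
    have := h1 y.right
    rw [← h2, hy] at this
    rw [show x = y.right from this]
    exact y.right.2
  · exact Or.inr ⟨b, b.2, congrArg Subtype.val hb.eq⟩

/-- If `G ≤ K` contains `C_K(v)`, then an element of `⟨G, s⟩ ≤ K(v, s)` is conjugate there into `G`
or its centralizer in `K(v, s)` is contained in `⟨G, s⟩`. -/
theorem exists_conj_or_centralizer_le (h : IsCE K L v s) {G : Subgroup Γ} (hG : G ≤ K)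
    (hC : ∀ x ∈ K, Commute x v → x ∈ G) {w : Γ} (hw : w ∈ G ⊔ Subgroup.zpowers s) :
    (∃ g ∈ G ⊔ Subgroup.zpowers s, g * w * g⁻¹ ∈ G) ∨
      ∀ x ∈ L, Commute x w → x ∈ G ⊔ Subgroup.zpowers s := by
  obtain ⟨e, h1, h2⟩ := h.exists_equiv
  rcases CosetFreeProduct.conj_mem_or_centralizer_le (f := L.subtype.comp e.toMonoidHom)
    (L.subtype_injective.comp e.injective) h1 h2 hG hC hw with h3 | h3
  · exact Or.inl h3
  · refine Or.inr fun x hx hxw => ?_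
    obtain ⟨k, hk⟩ := e.surjective ⟨x, hx⟩
    have hkx : L.subtype.comp e.toMonoidHom k = x := congrArg Subtype.val hk
    rw [← hkx] at hxw ⊢
    exact h3 k hxw

variable (hΓ : IsTorsionFreeCSA Γ)
include hΓ

theorem of_commute (h : IsCE K L v s) {w : Γ} (hw : w ∈ K) (hw1 : w ≠ 1) (hwv : Commute w v) :
    IsCE K L w s where
  mem := hw
  ne := hw1
  sup := h.sup
  comm c hc hcw := h.comm c hc (hΓ.trans w _ _ hw1 hcw hwv)
  lift T _ α τ hτ := h.lift T α τ fun c hc => hτ c (hΓ.trans v _ _ h.ne hc hwv.symm)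

theorem mul_left (h : IsCE K L v s) {c : Γ} (hc : c ∈ K) (hcv : Commute c v) :
    IsCE K L v (c * s) where
  mem := h.mem
  ne := h.ne
  sup := by
    refine le_antisymm (h.le_of_mem le_sup_left ?_) (sup_le h.le ((Subgroup.zpowers_le).mpr
      (mul_mem (h.le hc) h.letter_mem)))
    have := mul_mem (inv_mem (Subgroup.mem_sup_left hc))
      (Subgroup.mem_sup_right (S := K) (Subgroup.mem_zpowers (c * s)))
    rwa [inv_mul_cancel_left] at this
  comm k hk hkv := (hΓ.trans v _ _ h.ne hkv hcv.symm).mul_right (h.comm k hk hkv)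
  lift T _ α τ hτ := by
    obtain ⟨γ, h1, h2⟩ := h.lift T α ((α ⟨c, hc⟩)⁻¹ * τ) (fun k hk => by
      have : Commute k ⟨c, hc⟩ := Subtype.ext (hΓ.trans v _ _ h.ne hk hcv.symm).eq
      exact (this.map α).inv_right.mul_right (hτ k hk))
    refine ⟨γ, h1, fun hs => ?_⟩
    have : (⟨c * s, hs⟩ : L) = ⟨c, h.le hc⟩ * ⟨s, h.letter_mem⟩ := rfl
    rw [this, map_mul, h2, h1 c hc, mul_inv_cancel_left]

/-- If the centralizer of g grows, g is conjugate in K into C_K(v). By transitivity of commutation L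
is then also the extension of the centralizer of g, with a conjugate letter. -/
theorem forall_mem_or_exists (h : IsCE K L v s) {g : Γ} (hg : g ∈ K) (hg1 : g ≠ 1) :
    (∀ x ∈ L, Commute x g → x ∈ K) ∨ ∃ b ∈ K, Commute (b * g * b⁻¹) v ∧ IsCE K L g (b⁻¹ * s * b) := by
  by_cases hall : ∀ x ∈ L, Commute x g → x ∈ K
  · exact Or.inl hall
  push Not at hall
  obtain ⟨x, hx, hxg, hxK⟩ := hall
  obtain ⟨b, hb, hbv⟩ := (h.mem_or_exists_conj hg hx hxg).resolve_left hxK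
  refine Or.inr ⟨b, hb, hbv, ?_⟩
  have := (h.of_commute hΓ (mul_mem (mul_mem hb hg) (inv_mem hb))
    (fun e => hg1 (conj_eq_one_iff.mp e)) hbv).conj (inv_mem hb)
  rwa [show b⁻¹ * (b * g * b⁻¹) * b⁻¹⁻¹ = g by group, inv_inv] at this

/-- In the extension, the centralizer of v is C_K(v) × ⟨s⟩. -/
theorem exists_eq_mul_zpow (h : IsCE K L v s) {x : Γ} (hx : x ∈ L) (hxv : Commute x v) :
    ∃ c ∈ K, Commute c v ∧ ∃ n : ℤ, x = c * s ^ n := by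
  obtain ⟨e, h1, h2⟩ := h.exists_equiv
  obtain ⟨y, hy⟩ := e.surjective ⟨x, hx⟩
  have hc : Commute y (inr ⟨v, h.mem⟩) := by
    refine e.injective (Subtype.ext ?_)
    rw [map_mul, map_mul, hy, Subgroup.coe_mul, Subgroup.coe_mul, h1]
    exact hxv.eq
  have hv1 : (⟨v, h.mem⟩ : K) ≠ 1 := fun e => h.ne (congrArg Subtype.val e)
  have := mem_cosetSubgroup_of_commute_inr
    (hΓ.of_injective K.subtype K.subtype_injective) hv1 hv1 (Commute.refl _) hc
  obtain ⟨c, hcv, n, rfl⟩ := mem_cosetSubgroup_centralizer_iff.mp this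
  refine ⟨c, c.2, congrArg Subtype.val hcv.eq, n, ?_⟩
  rw [map_mul, map_zpow] at hy
  have := congrArg Subtype.val hy
  rw [Subgroup.coe_mul, Subgroup.coe_zpow, h1, h2] at this
  exact this.symm

omit hΓ in
/-- Commuting two extensions of centralizers of elements of `K`. -/
theorem swap_aux {w z : Γ} {K' : Subgroup Γ} (h : IsCE K L w z) (h' : IsCE L M v s)
    (h'' : IsCE K K' v s) (h1 : ∀ c ∈ K', Commute c w → Commute c z)
    (h2 : ∀ x ∈ L, Commute x v → ∃ c ∈ K, Commute c v ∧ ∃ n : ℤ, x = c * z ^ n ∧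
      (n ≠ 0 → Commute s w)) : IsCE K' M w z where
  mem := h''.le h.mem
  ne := h.ne
  sup := by
    refine le_antisymm (h'.le_of_mem (h.le_of_mem (h''.le.trans le_sup_left) ?_) ?_) ?_
    · exact Subgroup.mem_sup_right (Subgroup.mem_zpowers _)
    · exact Subgroup.mem_sup_left h''.letter_mem
    · exact sup_le (h''.le_of_mem (h.le.trans h'.le) h'.letter_mem)
        ((Subgroup.zpowers_le).mpr (h'.le h.letter_mem))
  comm := h1
  lift T _ α τ hτ := by
    -- The map is built in the original order, first on z and then on s. The second step needs τ to
    -- commute with the image of s only when a nonzero power of z occurs in the centralizer of v.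
    obtain ⟨γ₁, a1, a2⟩ := h.lift T (α.comp (Subgroup.inclusion h''.le)) τ (fun c hc => hτ _ hc)
    obtain ⟨γ, b1, b2⟩ := h'.lift T γ₁ (α ⟨s, h''.letter_mem⟩) (fun ⟨x, hx⟩ hxv => by
      obtain ⟨c, hc, hcv, n, rfl, hn⟩ := h2 x hx hxv
      have e : (⟨c * z ^ n, hx⟩ : L) = ⟨c, h.le hc⟩ * ⟨z, h.letter_mem⟩ ^ n := rfl
      rw [e, map_mul, map_zpow, a1 c hc, a2]
      refine Commute.mul_left ?_ ?_
      · have : Commute (⟨c, h''.le hc⟩ : K') ⟨s, h''.letter_mem⟩ :=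
          Subtype.ext (h''.comm c hc hcv).eq
        exact this.map α
      · rcases eq_or_ne n 0 with rfl | hn0
        · rw [zpow_zero]; exact Commute.one_left _
        · exact (hτ ⟨s, h''.letter_mem⟩ (hn hn0)).symm.zpow_left n)
    have hle : K' ≤ M := h''.le_of_mem (h.le.trans h'.le) h'.letter_mem
    have e : γ.comp (Subgroup.inclusion hle) = α := by
      refine h''.hom_ext (fun k hk => ?_) ?_
      · change γ ⟨k, _⟩ = _
        rw [b1 k (h.le hk), a1 k hk]; rfl
      · exact b2 _
    refine ⟨γ, fun k hk hk' => ?_, fun hs => ?_⟩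
    · rw [← e]; rfl
    · rw [b1 z h.letter_mem, a2]

theorem swap_same {z : Γ} (h : IsCE K L v z) (h' : IsCE L M v s) :
    IsCE (K ⊔ Subgroup.zpowers s) M v z := by
  have h'' := h.sup_zpowers h' h.mem
  have hzs : Commute s z := (h'.comm z h.letter_mem h.commute_letter.symm).symm
  refine swap_aux h h' h'' (fun c hc hcv => ?_) (fun x hx hxv => ?_)
  · obtain ⟨c', hc', hcv', n, rfl⟩ := h''.exists_eq_mul_zpow hΓ hc hcv
    exact (h.comm c' hc' hcv').mul_left (hzs.zpow_left n)
  · obtain ⟨c, hc, hcv, n, rfl⟩ := h.exists_eq_mul_zpow hΓ hx hxv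
    exact ⟨c, hc, hcv, n, rfl, fun _ => h'.commute_letter.symm⟩

/-- Either C_L(v) stays in K, and the two letters are independent, or L is itself an extension of
the centralizer of v, and both letters belong to v. -/
theorem swap {w z : Γ} (h : IsCE K L w z) (h' : IsCE L M v s) (hv : v ∈ K) :
    ∃ w' z', IsCE (K ⊔ Subgroup.zpowers s) M w' z' := by
  have h'' := h.sup_zpowers h' hv
  rcases h.forall_mem_or_exists hΓ hv h'.ne with h1 | ⟨b, hb, -, h1⟩
  · refine ⟨w, z, swap_aux h h' h'' (fun c hc hcw => ?_) (fun x hx hxv => ?_)⟩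
    · refine h.comm c ?_ hcw
      -- Otherwise w would be conjugate in K to an element commuting with v. The same conjugate of z
      -- would then commute with v and lie in K, forcing z ∈ K.
      by_contra hcK
      obtain ⟨b, hb, hbv⟩ := (h''.mem_or_exists_conj h.mem hc hcw).resolve_left hcK
      have h2 : Commute (b * z * b⁻¹) (b * w * b⁻¹) :=
        (Commute.conj_iff b).mpr h.commute_letter.symm
      have h3 := h1 _ (mul_mem (mul_mem (h.le hb) h.letter_mem) (inv_mem (h.le hb)))
        (hΓ.trans _ _ _ (fun e => h.ne (conj_eq_one_iff.mp e)) h2 hbv)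
      refine h.letter_notMem ?_
      have := mul_mem (mul_mem (inv_mem hb) h3) hb
      rwa [show b⁻¹ * (b * z * b⁻¹) * b = z by group] at this
    · exact ⟨x, h1 x hx hxv, hxv, 0, by simp, fun h => absurd rfl h⟩
  · exact ⟨v, _, h1.swap_same hΓ h'⟩

end IsCE

theorem isCEStep_iff {K L : Subgroup Γ} : IsCEStep K L ↔ ∃ v s, IsCE K L v s := by
  constructor
  · rintro ⟨h, v, hv, e, he⟩
    refine ⟨v, e HNNExtension.t, v.2, fun h1 => hv (Subtype.ext h1), ?_, fun c hc hcv => ?_,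
      fun T _ α τ hτ => ?_⟩
    · refine le_antisymm (fun x hx => ?_) (sup_le h ((Subgroup.zpowers_le).mpr (e _).2))
      obtain ⟨y, hy⟩ := e.surjective ⟨x, hx⟩
      have : ∀ y, (e y : Γ) ∈ K ⊔ Subgroup.zpowers (e HNNExtension.t : Γ) := fun y => by
        induction y using HNNExtension.induction_on with
        | of g => rw [he]; exact Subgroup.mem_sup_left g.2
        | t => exact Subgroup.mem_sup_right (Subgroup.mem_zpowers _)
        | mul x y hx hy => rw [map_mul]; exact mul_mem hx hy
        | inv x hx => rw [map_inv]; exact inv_mem hx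
      have := this y
      rwa [hy] at this
    · have h1 := HNNExtension.t_mul_of (φ := MulEquiv.refl (Subgroup.centralizer {v}))
        ⟨⟨c, hc⟩, Subgroup.mem_centralizer_iff_commute.mpr (Subtype.ext hcv.eq)⟩
      have h2 := congrArg (fun y => (e y : Γ)) h1.symm
      simp only [map_mul, Subgroup.coe_mul, MulEquiv.refl_apply] at h2
      rw [he] at h2
      exact h2
    · have hτ' : ∀ a : Subgroup.centralizer {v},
          τ * α a = α ((MulEquiv.refl (Subgroup.centralizer {v}) a : _) : K) * τ := fun a =>
        (hτ a (congrArg Subtype.val (Subgroup.mem_centralizer_iff_commute.mp a.2).eq)).symm.eq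
      refine ⟨(HNNExtension.lift α τ hτ').comp e.symm.toMonoidHom, fun k hk hk' => ?_,
        fun hs => ?_⟩
      · have : (⟨k, hk'⟩ : L) = e (HNNExtension.of ⟨k, hk⟩) := by rw [he]; rfl
        simp [this]
      · simp
  · rintro ⟨v, s, h⟩
    obtain ⟨e, h1, -⟩ := h.exists_equiv
    refine ⟨h.le, ⟨v, h.mem⟩, fun h2 => h.ne (congrArg Subtype.val h2),
      (CosetFreeProduct.equivCentralizerExtension _).trans e, fun k => Subtype.ext ?_⟩
    simp [h1]

end

/-! ### Iterated extensions: moving letters to the front, and cancellation -/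

section

variable {Γ : Type u} [Group Γ]

/-- `M` is obtained from `K` by `n` successive extensions of centralizers. -/
def IsICEOfLength : ℕ → Subgroup Γ → Subgroup Γ → Prop
  | 0, K, M => K = M
  | n + 1, K, M => ∃ L v s, IsCE K L v s ∧ IsICEOfLength n L M

theorem isICE_iff {K M : Subgroup Γ} : IsICE K M ↔ ∃ n, IsICEOfLength n K M := by
  constructor
  · intro h
    induction h using Relation.ReflTransGen.head_induction_on with
    | refl => exact ⟨0, rfl⟩
    | head h _ ih =>
      obtain ⟨n, hn⟩ := ih
      obtain ⟨v, s, hs⟩ := isCEStep_iff.mp h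
      exact ⟨n + 1, _, v, s, hs, hn⟩
  · rintro ⟨n, hn⟩
    induction n generalizing K with
    | zero => exact hn ▸ Relation.ReflTransGen.refl
    | succ n ih =>
      obtain ⟨L, v, s, h, hn⟩ := hn
      exact (ih hn).head (isCEStep_iff.mpr ⟨v, s, h⟩)

theorem IsCE.isICE {K L : Subgroup Γ} {v s : Γ} (h : IsCE K L v s) : IsICE K L :=
  Relation.ReflTransGen.single (isCEStep_iff.mpr ⟨v, s, h⟩)

theorem IsICEOfLength.isICE {n : ℕ} {K M : Subgroup Γ} (h : IsICEOfLength n K M) : IsICE K M :=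
  isICE_iff.mpr ⟨n, h⟩

theorem IsICEOfLength.le {n : ℕ} {K M : Subgroup Γ} (h : IsICEOfLength n K M) : K ≤ M := by
  induction n generalizing K with
  | zero => exact le_of_eq h
  | succ n ih =>
    obtain ⟨L, v, s, h, hn⟩ := h
    exact h.le.trans (ih hn)

theorem IsICE.le {K M : Subgroup Γ} (h : IsICE K M) : K ≤ M := by
  obtain ⟨n, hn⟩ := isICE_iff.mp h
  exact hn.le

theorem IsICEOfLength.exists_retraction {n : ℕ} {K M : Subgroup Γ} (h : IsICEOfLength n K M) :
    ∃ r : M →* K, ∀ k (hk : k ∈ K), r ⟨k, h.le hk⟩ = ⟨k, hk⟩ := by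
  induction n generalizing K with
  | zero =>
    obtain rfl : K = M := h
    exact ⟨MonoidHom.id K, fun _ _ => rfl⟩
  | succ n ih =>
    have hKM := h.le
    obtain ⟨L, v, s, h, hn⟩ := h
    obtain ⟨r, hr⟩ := ih hn
    obtain ⟨r', hr', -⟩ := h.exists_retraction
    exact ⟨r'.comp r, fun k hk => by rw [MonoidHom.comp_apply, hr k (h.le hk), hr' k hk]⟩

variable (hΓ : IsTorsionFreeCSA Γ)
include hΓ

/-- If the centralizer of `u ∈ K` grows in an iterated extension `M`, then `M` is an iterated
extension of an extension of the centralizer of `u` in `K`. -/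
theorem IsICEOfLength.exists_letter {n : ℕ} {K M : Subgroup Γ} {v x : Γ}
    (h : IsICEOfLength n K M) (hv : v ∈ K) (hv1 : v ≠ 1) (hx : x ∈ M) (hxv : Commute x v)
    (hxK : x ∉ K) : ∃ m, n = m + 1 ∧ ∃ L s, IsCE K L v s ∧ IsICEOfLength m L M := by
  induction n generalizing K with
  | zero =>
    obtain rfl : K = M := h
    exact absurd hx hxK
  | succ n ih =>
    refine ⟨n, rfl, ?_⟩
    obtain ⟨L, w, z, h, hn⟩ := h
    -- If the first step already enlarges the centralizer of v, its letter can be taken for v.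
    -- Otherwise the growth happens above L, and the letter found there is swapped past the first
    -- one.
    rcases h.forall_mem_or_exists hΓ hv hv1 with h1 | ⟨b, -, -, h1⟩
    · obtain ⟨m, rfl, L', s, h2, h3⟩ := ih hn (h.le hv) (fun hxL => hxK (h1 x hxL hxv))
      obtain ⟨w', z', h4⟩ := h.swap hΓ h2 hv
      exact ⟨_, _, h.sup_zpowers h2 hv, _, _, _, h4, h3⟩
    · exact ⟨L, _, h1, hn⟩

/-- Cancellation for a single extension of a centralizer. -/
theorem IsCE.isICE_of_isICEOfLength {n : ℕ} {G K M : Subgroup Γ} {w z : Γ}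
    (hGM : IsICEOfLength n G M) (hKM : IsCE K M w z) (hGK : G ≤ K) : IsICE G K := by
  induction n generalizing G w z with
  | zero =>
    obtain rfl : G = M := hGM
    exact absurd (hGK hKM.letter_mem) hKM.letter_notMem
  | succ n ih =>
  obtain ⟨G₁, u, s, hs, hn⟩ := hGM
  -- If the centralizer of u does not grow from K to M, the first letter s lies in K and can be
  -- absorbed into G. Otherwise M is an extension of K at u itself.
  rcases hKM.forall_mem_or_exists hΓ (hGK hs.mem) hs.ne with h1 | ⟨b, -, -, hz⟩
  · have hsK := h1 s (hn.le hs.letter_mem) hs.commute_letter.symm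
    exact hs.isICE.trans (ih hn hKM (hs.le_of_mem hGK hsK))
  clear hKM
  generalize b⁻¹ * z * b = z at hz
  obtain ⟨f, f1, f2⟩ := hz.exists_height
  obtain ⟨N, hN⟩ : ∃ N : ℕ, ∀ hs' : s ∈ M, (Multiplicative.toAdd (f ⟨s, hs'⟩)).natAbs = N :=
    ⟨(Multiplicative.toAdd (f ⟨s, hn.le hs.letter_mem⟩)).natAbs, fun _ => rfl⟩
  -- Inner induction on the absolute height of s, that is, on its exponent sum in z.
  induction N using Nat.strong_induction_on generalizing G₁ s with
  | _ N ihN =>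
  have hsM : s ∈ M := hn.le hs.letter_mem
  have hNs := hN hsM
  have hsu : Commute s u := hs.commute_letter.symm
  by_cases hN0 : N = 0
  -- Here s = c z^e with c ∈ K, and height zero means e = 0, so s ∈ K.
  · obtain ⟨c, hc, -, e, hce⟩ := hz.exists_eq_mul_zpow hΓ hsM hsu
    have h2 : f ⟨s, hsM⟩ = Multiplicative.ofAdd e := by
      have : (⟨s, hsM⟩ : M) = ⟨c, hz.le hc⟩ * ⟨z, hz.letter_mem⟩ ^ e := Subtype.ext hce
      rw [this, map_mul, map_zpow, f1 c hc, f2, one_mul, ← ofAdd_zsmul]; simp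
    have he : e = 0 := by
      rw [h2, toAdd_ofAdd] at hNs
      omega
    rw [he, zpow_zero, mul_one] at hce
    have hsK : s ∈ K := hce ▸ hc
    exact hs.isICE.trans (ih hn hz (hs.le_of_mem hGK hsK))
  by_cases hgrow : ∃ x ∈ M, Commute x u ∧ x ∉ G₁
  · obtain ⟨x, hx, hxu, hxG⟩ := hgrow
    obtain ⟨m, rfl, G₂, s₂, h2, h3⟩ := hn.exists_letter hΓ (hs.le hs.mem) hs.ne hx hxu hxG
    set q := Multiplicative.toAdd (f ⟨s₂, h3.le h2.letter_mem⟩) /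
      Multiplicative.toAdd (f ⟨s, hsM⟩) with hq
    have h4 := h2.mul_left hΓ (zpow_mem hs.letter_mem (-q)) (hsu.zpow_left _)
    have h5 := hs.swap_same hΓ h4
    refine ihN (Multiplicative.toAdd (f ⟨s ^ (-q) * s₂, h3.le h4.letter_mem⟩)).natAbs ?_ _ _
      (hs.sup_zpowers h4 hs.mem) ⟨_, _, _, h5, h3⟩ (fun _ => rfl)
    have e : (⟨s ^ (-q) * s₂, h3.le h4.letter_mem⟩ : M) =
        ⟨s, hsM⟩ ^ (-q) * ⟨s₂, h3.le h2.letter_mem⟩ := rfl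
    rw [e, map_mul, map_zpow, toAdd_mul, toAdd_zpow, ← hNs]
    have hne : Multiplicative.toAdd (f ⟨s, hsM⟩) ≠ 0 := by omega
    have e2 : -q • Multiplicative.toAdd (f ⟨s, hsM⟩) +
        Multiplicative.toAdd (f ⟨s₂, h3.le h2.letter_mem⟩) =
        Multiplicative.toAdd (f ⟨s₂, h3.le h2.letter_mem⟩) %
          Multiplicative.toAdd (f ⟨s, hsM⟩) := by
      rw [Int.emod_def, hq, smul_eq_mul]; ring
    rw [e2]
    have h6 := Int.emod_nonneg (Multiplicative.toAdd (f ⟨s₂, h3.le h2.letter_mem⟩)) hne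
    have h7 := Int.emod_lt_abs (Multiplicative.toAdd (f ⟨s₂, h3.le h2.letter_mem⟩)) hne
    rw [Int.abs_eq_natAbs] at h7
    omega
  push Not at hgrow
  have hG₁M := hn.le
  have hzu : Commute z u := hz.commute_letter.symm
  -- Now C_M(u) lies in G₁, so z = c s^e with c ∈ G. Comparing heights gives e = ±1, and s itself
  -- serves as the letter of M over K.
  obtain ⟨c, hc, hcu, e, hce⟩ := hs.exists_eq_mul_zpow hΓ (hgrow z hz.letter_mem hzu) hzu
  have height : ∀ (c : Γ) (hc : c ∈ G) (k : ℤ) (hm : c * s ^ k ∈ M),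
      Multiplicative.toAdd (f ⟨c * s ^ k, hm⟩) = k * Multiplicative.toAdd (f ⟨s, hsM⟩) := by
    intro c hc k hm
    have : (⟨c * s ^ k, hm⟩ : M) = ⟨c, hz.le (hGK hc)⟩ * ⟨s, hsM⟩ ^ k := rfl
    rw [this, map_mul, map_zpow, f1 c (hGK hc), one_mul, toAdd_zpow, smul_eq_mul]
  have he : e * Multiplicative.toAdd (f ⟨s, hsM⟩) = 1 := by
    have := height c hc e (hce ▸ hz.letter_mem)
    rw [← this]
    have e1 : (⟨c * s ^ e, hce ▸ hz.letter_mem⟩ : M) = ⟨z, hz.letter_mem⟩ := Subtype.ext hce.symm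
    rw [e1, f2]; rfl
  have hKs : IsCE K M u s := by
    have h1 := hz.mul_left hΓ (inv_mem (hGK hc)) hcu.inv_left
    have h2 : c⁻¹ * z = s ^ e := by rw [hce, inv_mul_cancel_left]
    rw [h2] at h1
    rcases Int.eq_one_or_neg_one_of_mul_eq_one he with rfl | rfl
    · rwa [zpow_one] at h1
    · have := h1.inv
      rwa [zpow_neg, zpow_one, inv_inv] at this
  -- An element of C_K(u) has the form c' s^k with c' ∈ G and has height zero, whence k = 0.
  have hCG : ∀ x ∈ K, Commute x u → x ∈ G := by
    intro x hx hxu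
    obtain ⟨c', hc', -, k, rfl⟩ := hs.exists_eq_mul_zpow hΓ (hgrow x (hz.le hx) hxu) hxu
    have := height c' hc' k (hz.le hx)
    rw [f1 _ hx, toAdd_one, eq_comm, mul_eq_zero] at this
    rcases this with rfl | h0
    · simpa using hc'
    · rw [h0, mul_zero] at he
      exact absurd he (by decide)
  rcases n with _ | n
  · obtain rfl : G₁ = M := hn
    -- With a single step M = ⟨G, s⟩, and the retraction of M onto K that kills s maps ⟨G, s⟩ into
    -- G.
    have : G = K := by
      refine le_antisymm hGK fun x hx => ?_
      obtain ⟨r, r1, r2⟩ := hKs.exists_retraction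
      have h1 : G₁ ≤ ((G.subgroupOf K).comap r).map G₁.subtype := by
        refine hs.le_of_mem (fun g hg => ⟨⟨g, hs.le hg⟩, ?_, rfl⟩) ⟨⟨s, hs.letter_mem⟩, ?_, rfl⟩
        · change (r _ : Γ) ∈ G
          rw [r1 g (hGK hg)]
          exact hg
        · change (r _ : Γ) ∈ G
          rw [r2]
          exact one_mem _
      obtain ⟨⟨y, hy⟩, hy', rfl⟩ := h1 (hKs.le hx)
      change (r _ : Γ) ∈ G at hy'
      change y ∈ K at hx
      rw [r1 y hx] at hy'
      exact hy'
    rw [this]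
    exact Relation.ReflTransGen.refl
  obtain ⟨G₂, v, t, ht, hn⟩ := hn
  have hG₂M := hn.le
  have hvs : v ∈ G ⊔ Subgroup.zpowers s := hs.sup ▸ ht.mem
  -- The next letter t commutes with v but lies outside ⟨G, s⟩, so v must be conjugate in ⟨G, s⟩
  -- into G. After conjugating, t can be swapped to the front.
  rcases hKs.exists_conj_or_centralizer_le hGK hCG hvs with ⟨g, hg, hgv⟩ | h1
  swap
  · have := h1 t (hG₂M ht.letter_mem) ht.commute_letter.symm
    rw [← hs.sup] at this
    exact absurd this ht.letter_notMem
  rw [← hs.sup] at hg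
  have ht' := ht.conj hg
  clear ht
  generalize g * v * g⁻¹ = v at ht' hgv
  generalize g * t * g⁻¹ = t at ht'
  obtain ⟨w', z', h3⟩ := hs.swap hΓ ht' hgv
  have h4 := hs.sup_zpowers ht' hgv
  -- If t ∉ K, some b ∈ K conjugates v into C_K(u) ≤ G. The retraction of M onto G replaces b by a ∈
  -- G with the same effect on v. Then a t a⁻¹ centralizes u, so it lies in G₁, and so does t, a
  -- contradiction.
  have htK : t ∈ K := by
    by_contra htK
    obtain ⟨b, hb, hbu⟩ := (hKs.mem_or_exists_conj (hGK hgv) (hG₂M ht'.letter_mem)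
      ht'.commute_letter.symm).resolve_left htK
    have hcG : b * v * b⁻¹ ∈ G :=
      hCG _ (mul_mem (mul_mem hb (hGK hgv)) (inv_mem hb)) hbu
    have hGM' : IsICEOfLength (n + 1 + 1) G M := ⟨_, _, _, h4, _, _, _, h3, hn⟩
    obtain ⟨r, hr⟩ := hGM'.exists_retraction
    set a : Γ := (r ⟨b, hz.le hb⟩ : Γ) with ha
    have haG : a ∈ G := (r ⟨b, hz.le hb⟩).2
    have e1 : b * v * b⁻¹ = a * v * a⁻¹ := by
      have e2 : (⟨b * v * b⁻¹, hz.le (hGK hcG)⟩ : M) =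
        ⟨b, hz.le hb⟩ * ⟨v, hz.le (hGK hgv)⟩ * ⟨b, hz.le hb⟩⁻¹ := rfl
      have e3 := congrArg (fun y => (r y : Γ)) e2
      simp only [map_mul, map_inv] at e3
      rw [hr _ hcG, hr _ hgv] at e3
      exact e3
    rw [e1] at hbu
    have h5 : Commute (a * t * a⁻¹) (a * v * a⁻¹) :=
      (Commute.conj_iff a).mpr ht'.commute_letter.symm
    have h6 : Commute (a * t * a⁻¹) u :=
      hΓ.trans _ _ _ (fun e => ht'.ne (conj_eq_one_iff.mp e)) h5 hbu
    have h7 := hgrow _ (mul_mem (mul_mem (hz.le (hGK haG)) (hG₂M ht'.letter_mem))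
      (inv_mem (hz.le (hGK haG)))) h6
    have h8 := mul_mem (mul_mem (inv_mem (hs.le haG)) h7) (hs.le haG)
    rw [show a⁻¹ * (a * t * a⁻¹) * a = t by group] at h8
    exact ht'.letter_notMem h8
  exact h4.isICE.trans (ih ⟨_, _, _, h3, hn⟩ hz (h4.le_of_mem hGK htK))

/-- Iterated centralizer extensions satisfy cancellation. -/
theorem IsICE.of_isICE_of_le {G K M : Subgroup Γ} (hG : IsICE G M) (hK : IsICE K M)
    (hGK : G ≤ K) : IsICE G K := by
  obtain ⟨n, hn⟩ := isICE_iff.mp hK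
  clear hK
  -- Descent from M to K, one centralizer extension at a time.
  induction n generalizing K with
  | zero =>
    obtain rfl : K = M := hn
    exact hG
  | succ n ih =>
    obtain ⟨L, v, s, h, hn⟩ := hn
    obtain ⟨m, hm⟩ := isICE_iff.mp (ih (hGK.trans h.le) hn)
    exact h.isICE_of_isICEOfLength hΓ hm hGK

end

/-! ### Transfer along embeddings -/

section

section Transfer

variable {Γ Δ : Type u} [Group Γ] [Group Δ] {f : Γ →* Δ} (hf : Function.Injective f)
include hf

theorem commute_of_injective {x y : Γ} (h : Commute (f x) (f y)) : Commute x y :=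
  hf (by simpa using h.eq)

theorem IsCE.map {K L : Subgroup Γ} {v s : Γ} (h : IsCE K L v s) :
    IsCE (K.map f) (L.map f) (f v) (f s) where
  mem := Subgroup.mem_map_of_mem f h.mem
  ne e := h.ne (hf (by rw [e, map_one]))
  sup := by rw [h.sup, Subgroup.map_sup, MonoidHom.map_zpowers]
  comm := by
    rintro _ ⟨c, hc, rfl⟩ hcv
    exact (h.comm c hc (commute_of_injective hf hcv)).map f
  lift T _ α τ hτ := by
    obtain ⟨γ, h1, h2⟩ := h.lift T (α.comp (K.equivMapOfInjective f hf).toMonoidHom) τ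
      (fun c hc => hτ _ (hc.map f))
    refine ⟨γ.comp (L.equivMapOfInjective f hf).symm.toMonoidHom, ?_, fun hs => ?_⟩
    · rintro _ ⟨k, hk, rfl⟩ hk'
      have e : (⟨f k, hk'⟩ : L.map f) = L.equivMapOfInjective f hf ⟨k, h.le hk⟩ := rfl
      rw [e]
      change γ ((L.equivMapOfInjective f hf).symm (L.equivMapOfInjective f hf _)) = _
      rw [MulEquiv.symm_apply_apply, h1 k hk]
      rfl
    · have e : (⟨f s, hs⟩ : L.map f) = L.equivMapOfInjective f hf ⟨s, h.letter_mem⟩ := rfl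
      rw [e]
      change γ ((L.equivMapOfInjective f hf).symm (L.equivMapOfInjective f hf _)) = _
      rw [MulEquiv.symm_apply_apply, h2]

theorem IsCE.of_map {K L : Subgroup Γ} {w z : Δ} (h : IsCE (K.map f) (L.map f) w z) :
    ∃ v s, IsCE K L v s := by
  obtain ⟨v, hv, rfl⟩ := h.mem
  obtain ⟨s, hs, rfl⟩ := h.letter_mem
  refine ⟨v, s, hv, fun e => h.ne (by rw [e, map_one]), ?_, fun c hc hcv => ?_,
    fun T _ α τ hτ => ?_⟩
  · refine Subgroup.map_injective hf ?_
    rw [h.sup, Subgroup.map_sup, MonoidHom.map_zpowers]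
  · exact commute_of_injective hf (h.comm _ (Subgroup.mem_map_of_mem f hc) (hcv.map f))
  · obtain ⟨γ, h1, h2⟩ := h.lift T (α.comp (K.equivMapOfInjective f hf).symm.toMonoidHom) τ (by
      rintro ⟨_, c, hc, rfl⟩ hcv
      have e : (⟨f c, c, hc, rfl⟩ : K.map f) = K.equivMapOfInjective f hf ⟨c, hc⟩ := rfl
      rw [e]
      change Commute (α ((K.equivMapOfInjective f hf).symm (K.equivMapOfInjective f hf _))) τ
      rw [MulEquiv.symm_apply_apply]
      exact hτ _ (commute_of_injective hf hcv))
    refine ⟨γ.comp (L.equivMapOfInjective f hf).toMonoidHom, fun k hk hk' => ?_, fun hs => h2 _⟩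
    refine (h1 (f k) (Subgroup.mem_map_of_mem f hk) _).trans ?_
    have e : (⟨f k, Subgroup.mem_map_of_mem f hk⟩ : K.map f) =
      K.equivMapOfInjective f hf ⟨k, hk⟩ := rfl
    rw [e]
    change α ((K.equivMapOfInjective f hf).symm (K.equivMapOfInjective f hf _)) = _
    rw [MulEquiv.symm_apply_apply]

theorem isICE_map_iff {K M : Subgroup Γ} : IsICE (K.map f) (M.map f) ↔ IsICE K M := by
  rw [isICE_iff, isICE_iff]
  refine exists_congr fun n => ⟨fun h => ?_, fun h => ?_⟩
  · induction n generalizing K with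
    | zero => exact Subgroup.map_injective hf h
    | succ n ih =>
      obtain ⟨L, v, s, h, hn⟩ := h
      have hL : (L.comap f).map f = L :=
        Subgroup.map_comap_eq_self (hn.le.trans (Subgroup.map_le_range f M))
      rw [← hL] at h hn
      obtain ⟨v, s, h'⟩ := h.of_map hf
      exact ⟨_, v, s, h', ih hn⟩
  · induction n generalizing K with
    | zero => exact congrArg (Subgroup.map f) h
    | succ n ih =>
      obtain ⟨L, v, s, h, hn⟩ := h
      exact ⟨_, _, _, h.map hf, ih hn⟩

end Transfer

/-! ### Extension of isomorphisms, and back and forth -/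

section Extension

variable {Γ Δ : Type u} [Group Γ] [Group Δ]

/-- The two universal properties give mutually inverse maps, each sending one letter to the other.
-/
theorem IsCE.exists_extend {K K' : Subgroup Γ} {L L' : Subgroup Δ} {v t : Γ} {w s : Δ}
    (hK : IsCE K K' v t) (hL : IsCE L L' w s) (f : K ≃* L) (hvw : (f ⟨v, hK.mem⟩ : Δ) = w) :
    ∃ f' : K' ≃* L', ∀ k (hk : k ∈ K), (f' ⟨k, hK.le hk⟩ : Δ) = f ⟨k, hk⟩ := by
  have hvw' : f ⟨v, hK.mem⟩ = ⟨w, hL.mem⟩ := Subtype.ext hvw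
  have hwv' : f.symm ⟨w, hL.mem⟩ = ⟨v, hK.mem⟩ := by rw [← hvw', MulEquiv.symm_apply_apply]
  obtain ⟨γ, g1, g2⟩ := hK.lift L' ((Subgroup.inclusion hL.le).comp f.toMonoidHom)
    ⟨s, hL.letter_mem⟩ (fun c hc => Subtype.ext (hL.comm _ (f c).2 (by
      have h1 : Commute c ⟨v, hK.mem⟩ := Subtype.ext hc.eq
      have h2 := h1.map f
      rw [hvw'] at h2
      exact congrArg Subtype.val h2.eq)).eq)
  obtain ⟨δ, d1, d2⟩ := hL.lift K' ((Subgroup.inclusion hK.le).comp f.symm.toMonoidHom)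
    ⟨t, hK.letter_mem⟩ (fun c hc => Subtype.ext (hK.comm _ (f.symm c).2 (by
      have h1 : Commute c ⟨w, hL.mem⟩ := Subtype.ext hc.eq
      have h2 := h1.map f.symm
      rw [hwv'] at h2
      exact congrArg Subtype.val h2.eq)).eq)
  refine ⟨MonoidHom.toMulEquiv γ δ ?_ ?_, fun k hk => ?_⟩
  · refine hK.hom_ext (fun k hk => ?_) ?_
    · rw [MonoidHom.comp_apply, g1 k hk]
      refine (d1 _ (f ⟨k, hk⟩).2 _).trans ?_
      simp
      rfl
    · rw [MonoidHom.comp_apply, g2, d2]; rfl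
  · refine hL.hom_ext (fun k hk => ?_) ?_
    · rw [MonoidHom.comp_apply, d1 k hk]
      refine (g1 _ (f.symm ⟨k, hk⟩).2 _).trans ?_
      simp
      rfl
    · rw [MonoidHom.comp_apply, d2, g2]; rfl
  · exact congrArg Subtype.val (g1 k hk (hK.le hk))

/-- Subgroups satisfying `P` admit all extensions of centralizers inside the ambient group. -/
def HasCentralizerExtensions (P : Subgroup Γ → Prop) : Prop :=
  ∀ L, P L → ∀ v ∈ L, v ≠ 1 → ∃ L' s, IsCE L L' v s ∧ P L'

/-- Subgroups satisfying `P` have iterated centralizer extensions that exhaust the ambient group. -/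
def IsExhaustive (P : Subgroup Γ → Prop) : Prop :=
  ∀ L, P L → ∀ h, ∃ L', P L' ∧ IsICE L L' ∧ h ∈ L'

theorem HasCentralizerExtensions.exists_extend {P : Subgroup Δ → Prop}
    (hP : HasCentralizerExtensions P) {K M : Subgroup Γ} (hKM : IsICE K M) {L : Subgroup Δ}
    (hL : P L) (f : K ≃* L) :
    ∃ L', P L' ∧ ∃ f' : M ≃* L', ∀ k (hk : k ∈ K), (f' ⟨k, hKM.le hk⟩ : Δ) = f ⟨k, hk⟩ := by
  obtain ⟨n, hn⟩ := isICE_iff.mp hKM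
  induction n generalizing K L with
  | zero =>
    obtain rfl : K = M := hn
    exact ⟨L, hL, f, fun k hk => rfl⟩
  | succ n ih =>
    obtain ⟨K', v, t, h, hn⟩ := hn
    obtain ⟨L₁, s, hL₁, hPL₁⟩ := hP L hL _ (f ⟨v, h.mem⟩).2 (fun e => h.ne (by
      have e1 : f ⟨v, h.mem⟩ = 1 := Subtype.ext e
      exact congrArg Subtype.val ((map_eq_one_iff f f.injective).mp e1)))
    obtain ⟨f₁, hf₁⟩ := h.exists_extend hL₁ f rfl
    obtain ⟨L', hL', f', hf'⟩ := ih hn.isICE hPL₁ f₁ hn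
    exact ⟨L', hL', f', fun k hk => (hf' k (h.le hk)).trans (hf₁ k hk)⟩

/-- Isomorphisms between subgroups satisfying given properties. -/
structure PartialIso (P : Subgroup Γ → Prop) (Q : Subgroup Δ → Prop) where
  /-- The domain. -/
  dom : Subgroup Γ
  /-- The range. -/
  cod : Subgroup Δ
  /-- The isomorphism. -/
  equiv : dom ≃* cod
  dom_prop : P dom
  cod_prop : Q cod

instance (P : Subgroup Γ → Prop) (Q : Subgroup Δ → Prop) : Preorder (PartialIso P Q) where
  le x y := ∃ h : x.dom ≤ y.dom, ∀ k (hk : k ∈ x.dom),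
    (y.equiv ⟨k, h hk⟩ : Δ) = x.equiv ⟨k, hk⟩
  le_refl x := ⟨le_rfl, fun _ _ => rfl⟩
  le_trans x y z := fun ⟨h1, h2⟩ ⟨h3, h4⟩ =>
    ⟨h1.trans h3, fun k hk => (h4 k (h1 hk)).trans (h2 k hk)⟩

variable {P : Subgroup Γ → Prop} {Q : Subgroup Δ → Prop}

theorem PartialIso.isCofinal_dom (hP : IsExhaustive P) (hQ : HasCentralizerExtensions Q) (g : Γ) :
    IsCofinal {x : PartialIso P Q | g ∈ x.dom} := by
  intro x
  obtain ⟨K', hK', hice, hg⟩ := hP x.dom x.dom_prop g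
  obtain ⟨L', hL', f', hf'⟩ := hQ.exists_extend hice x.cod_prop x.equiv
  exact ⟨⟨K', L', f', hK', hL'⟩, hg, hice.le, hf'⟩

theorem PartialIso.isCofinal_cod (hP : HasCentralizerExtensions P) (hQ : IsExhaustive Q) (g : Δ) :
    IsCofinal {x : PartialIso P Q | g ∈ x.cod} := by
  intro x
  obtain ⟨L', hL', hice, hg⟩ := hQ x.cod x.cod_prop g
  obtain ⟨K', hK', f', hf'⟩ := hP.exists_extend hice x.dom_prop x.equiv.symm
  have key : ∀ k (hk : k ∈ x.dom), (f' ⟨x.equiv ⟨k, hk⟩, hice.le (x.equiv ⟨k, hk⟩).2⟩ : Γ) = k := by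
    intro k hk
    rw [hf' _ (x.equiv ⟨k, hk⟩).2]
    simp
  have hle : x.dom ≤ K' := fun k hk => by
    rw [← key k hk]
    exact (f' _).2
  refine ⟨⟨K', L', f'.symm, hK', hL'⟩, hg, hle, fun k hk => ?_⟩
  have : (⟨k, hle hk⟩ : K') = f' ⟨x.equiv ⟨k, hk⟩, hice.le (x.equiv ⟨k, hk⟩).2⟩ :=
    Subtype.ext (key k hk).symm
  change (f'.symm ⟨k, hle hk⟩ : Δ) = _
  rw [this, MulEquiv.symm_apply_apply]

/-- Back and forth. -/
theorem exists_mulEquiv_extending [Countable Γ] [Countable Δ] (hP : HasCentralizerExtensions P)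
    (hP' : IsExhaustive P) (hQ : HasCentralizerExtensions Q) (hQ' : IsExhaustive Q)
    {K : Subgroup Γ} {L : Subgroup Δ} (hK : P K) (hL : Q L) (f : K ≃* L) :
    ∃ σ : Γ ≃* Δ, ∀ k : K, σ k = f k := by
  have := Encodable.ofCountable Γ
  have := Encodable.ofCountable Δ
  let D : Γ ⊕ Δ → Order.Cofinal (PartialIso P Q) :=
    Sum.elim (fun g => ⟨_, PartialIso.isCofinal_dom hP' hQ g⟩)
      (fun g => ⟨_, PartialIso.isCofinal_cod hP hQ' g⟩)
  let p : PartialIso P Q := ⟨K, L, f, hK, hL⟩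
  -- An ideal of partial isomorphisms containing p and meeting the countably many cofinal sets "g is
  -- in the domain" and "d is in the range". Directedness makes its union the graph of an
  -- isomorphism.
  let I := Order.idealOfCofinals p D
  let R : Γ → Δ → Prop := fun g d => ∃ x ∈ I, ∃ h : g ∈ x.dom, (x.equiv ⟨g, h⟩ : Δ) = d
  have hdom : ∀ g, ∃ d, R g d := fun g => by
    obtain ⟨x, hx, hxI⟩ := Order.cofinal_meets_idealOfCofinals p D (Sum.inl g)
    exact ⟨_, x, hxI, hx, rfl⟩
  have hcod : ∀ d, ∃ g, R g d := fun d => by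
    obtain ⟨x, hx, hxI⟩ := Order.cofinal_meets_idealOfCofinals p D (Sum.inr d)
    exact ⟨x.equiv.symm ⟨d, hx⟩, x, hxI, (x.equiv.symm ⟨d, hx⟩).2, by simp⟩
  have hcommon : ∀ g d g' d', R g d → R g' d' → ∃ x : PartialIso P Q, x ∈ I ∧
      ∃ (h : g ∈ x.dom) (h' : g' ∈ x.dom), (x.equiv ⟨g, h⟩ : Δ) = d ∧
        (x.equiv ⟨g', h'⟩ : Δ) = d' := by
    rintro g _ g' _ ⟨x, hx, h, rfl⟩ ⟨y, hy, h', rfl⟩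
    obtain ⟨z, hz, ⟨h1, h2⟩, h3, h4⟩ := I.directed x hx y hy
    exact ⟨z, hz, h1 h, h3 h', h2 _ _, h4 _ _⟩
  have huniq : ∀ g d d', R g d → R g d' → d = d' := fun g d d' h h' => by
    obtain ⟨x, -, h1, h2, rfl, rfl⟩ := hcommon g d g d' h h'
    rfl
  have huniq' : ∀ g g' d, R g d → R g' d → g = g' := fun g g' d h h' => by
    obtain ⟨x, -, h1, h2, e1, e2⟩ := hcommon g d g' d h h'
    exact congrArg Subtype.val (x.equiv.injective (Subtype.ext (e1.trans e2.symm)))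
  have hmul : ∀ g d g' d', R g d → R g' d' → R (g * g') (d * d') := fun g d g' d' h h' => by
    obtain ⟨x, hx, h1, h2, rfl, rfl⟩ := hcommon g d g' d' h h'
    refine ⟨x, hx, mul_mem h1 h2, ?_⟩
    rw [← Subgroup.coe_mul, ← map_mul]
    rfl
  choose σ hσ using hdom
  let φ : Γ →* Δ := MonoidHom.mk' σ fun g g' =>
    huniq _ _ _ (hσ _) (hmul _ _ _ _ (hσ g) (hσ g'))
  refine ⟨MulEquiv.ofBijective φ ⟨fun g g' h => ?_, fun d => ?_⟩, fun k => ?_⟩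
  · have h' : σ g = σ g' := h
    exact huniq' _ _ _ (hσ g) (h' ▸ hσ g')
  · obtain ⟨g, hg⟩ := hcod d
    exact ⟨g, huniq _ _ _ (hσ g) hg⟩
  · exact huniq _ _ _ (hσ k) ⟨p, Order.mem_idealOfCofinals p D, k.2, rfl⟩

end Extension

/-! ### Fraïssé limits: extension property and uniqueness -/

section FraisseLimit

variable {G H : Type u} [Group G] [Group H] {j : G →* H}

theorem subgroupMemICE_iff {K : Subgroup H} :
    SubgroupMemICE j K ↔ Function.Injective j ∧ IsICE j.range K := by
  have key : ∀ h : ∀ g, j g ∈ K, IsICE (j.codRestrict K h).range ⊤ ↔ IsICE j.range K := by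
    intro h
    rw [← isICE_map_iff K.subtype_injective, ← MonoidHom.range_eq_map, Subgroup.range_subtype,
      MonoidHom.map_range]
    rfl
  constructor
  · rintro ⟨h, hinj, hice⟩
    exact ⟨fun x y hxy => hinj (Subtype.ext hxy), (key h).mp hice⟩
  · rintro ⟨hinj, hice⟩
    have h : ∀ g, j g ∈ K := fun g => hice.le ⟨g, rfl⟩
    exact ⟨h, fun x y hxy => hinj (congrArg Subtype.val hxy), (key h).mpr hice⟩

theorem IsICEChain.isICE {M : ℕ → Subgroup H} (hM : IsICEChain j M) {m n : ℕ} (h : m ≤ n) :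
    IsICE (M m) (M n) := by
  induction n, h using Nat.le_induction with
  | base => exact Relation.ReflTransGen.refl
  | succ n _ ih => exact ih.trans (hM.step n)

theorem IsICEChain.isICESubgroup {M : ℕ → Subgroup H} (hM : IsICEChain j M) (n : ℕ) :
    IsICESubgroup j (M n) :=
  ⟨(subgroupMemICE_iff.mp (hM.mem n)).2.le, M, hM, n, Relation.ReflTransGen.refl⟩

theorem IsICEChain.isICESubgroup_range {M : ℕ → Subgroup H} (hM : IsICEChain j M) :
    IsICESubgroup j j.range :=
  ⟨le_rfl, M, hM, 0, (subgroupMemICE_iff.mp (hM.mem 0)).2⟩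

variable (j) in
theorem isExhaustive_isICESubgroup : IsExhaustive (IsICESubgroup j) := by
  rintro K ⟨-, M, hM, n, hn⟩ h
  obtain ⟨m, hm⟩ := hM.union h
  exact ⟨M (max n m), hM.isICESubgroup _, hn.trans (hM.isICE (le_max_left _ _)),
    (hM.isICE (le_max_right _ _)).le hm⟩

theorem IsICESubgroup.map {K : Subgroup H} (hK : IsICESubgroup j K) (σ : H ≃* H)
    (hσ : ∀ g, σ (j g) = j g) : IsICESubgroup j (K.map σ.toMonoidHom) := by
  have hr : j.range.map σ.toMonoidHom = j.range := by
    rw [MonoidHom.map_range]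
    congr 1
    ext g
    exact hσ g
  obtain ⟨h1, M, hM, n, hn⟩ := hK
  have hinj : Function.Injective σ.toMonoidHom := σ.injective
  refine ⟨?_, fun n => (M n).map σ.toMonoidHom, ⟨fun n => ?_, fun n => ?_, fun h => ?_⟩, n, ?_⟩
  · rw [← hr]
    exact Subgroup.map_mono h1
  · rw [subgroupMemICE_iff, ← hr, isICE_map_iff hinj]
    exact subgroupMemICE_iff.mp (hM.mem n)
  · exact (isICE_map_iff hinj).mpr (hM.step n)
  · obtain ⟨n, hn⟩ := hM.union (σ.symm h)
    exact ⟨n, σ.symm h, hn, σ.apply_symm_apply h⟩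
  · exact (isICE_map_iff hinj).mpr hn

open CosetFreeProduct SemidirectProduct in
theorem isCE_range_inr {A : Type u} [Group A] {v : A} (hv : v ≠ 1) :
    IsCE (inr : A →* CosetFreeProduct A v).range ⊤ (inr v) (stable v) where
  mem := ⟨v, rfl⟩
  ne e := hv (inr_injective (e.trans (map_one inr).symm))
  sup := by
    refine le_antisymm (fun y _ => ?_) le_top
    refine cosetSubgroup_le (B := ⊤) 
      (P := (inr : A →* CosetFreeProduct A v).range ⊔ Subgroup.zpowers (stable v))
      (fun b _ => Subgroup.mem_sup_left (MonoidHom.mem_range.mpr ⟨b, rfl⟩)) (Subgroup.mem_sup_right (Subgroup.mem_zpowers _)) ⟨fun p _ => ?_, trivial⟩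
    obtain ⟨b, hb⟩ := QuotientGroup.mk_surjective p.1
    exact ⟨b, trivial, hb.symm⟩
  comm := by
    rintro _ ⟨c, rfl⟩ hcv
    exact commute_inr_stable (commute_of_injective inr_injective hcv)
  lift T _ α τ hτ := by
    have hc : ∀ c, Commute c v → Commute (α.comp inr.rangeRestrict c) τ :=
      fun c hc => hτ ⟨inr c, c, rfl⟩ (hc.map inr)
    refine ⟨(CosetFreeProduct.lift (α.comp inr.rangeRestrict) τ hc).comp (Subgroup.subtype ⊤),
      ?_, fun _ => ?_⟩
    · rintro _ ⟨k, rfl⟩ _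
      exact CosetFreeProduct.lift_inr (h := hc) k
    · exact CosetFreeProduct.lift_stable (h := hc)

-- The abstract extension L(v,t) is in ICE(G), hence in the age. The copy of L inside its
-- realization need not be L, but homogeneity supplies an automorphism fixing the image of G that
-- moves it onto L, and the realization along with it.
open CosetFreeProduct SemidirectProduct in
theorem IsICEFraisseLimit.hasCentralizerExtensions (h : IsICEFraisseLimit j) :
    HasCentralizerExtensions (IsICESubgroup j) := by
  intro L hL v hv hv1
  have hjL : ∀ g, j g ∈ L := fun g => hL.1 ⟨g, rfl⟩
  have hι : MemICE (j.codRestrict L hjL) :=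
    (h.age L _).mp ⟨L, hL, MulEquiv.refl L, fun g => rfl⟩
  set B := CosetFreeProduct L ⟨v, hv⟩
  have hCE : IsCE (inr : L →* B).range ⊤ (inr ⟨v, hv⟩) (stable _) :=
    isCE_range_inr fun e => hv1 (congrArg Subtype.val e)
  have hB : MemICE ((inr : L →* B).comp (j.codRestrict L hjL)) := by
    refine ⟨inr_injective.comp hι.1, ?_⟩
    have := (isICE_map_iff (f := (inr : L →* B)) inr_injective).mpr hι.2
    rw [← MonoidHom.range_eq_map, MonoidHom.map_range] at this
    exact this.trans hCE.isICE
  obtain ⟨K', hK', e, he⟩ := (h.age B _).mpr hB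
  obtain ⟨f, hf, hfinj, hfr⟩ : ∃ f : B →* H, (∀ y, f y = e y) ∧ Function.Injective f ∧
      f.range = K' := by
    refine ⟨K'.subtype.comp e.toMonoidHom, fun _ => rfl, K'.subtype_injective.comp e.injective, ?_⟩
    rw [← MonoidHom.map_range, MonoidHom.range_eq_top.mpr e.surjective, ← MonoidHom.range_eq_map,
      Subgroup.range_subtype]
  have hf' : ∀ g, f (inr ⟨j g, hjL g⟩) = j g := fun g => (hf _).trans (he g)
  have hCE' := hCE.map hfinj
  rw [← MonoidHom.range_eq_map, hfr, MonoidHom.map_range] at hCE'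
  obtain ⟨h1, M, hM, n, hn⟩ := hK'
  have hL' : IsICESubgroup j (f.comp inr).range := by
    refine ⟨?_, M, hM, n, hCE'.isICE.trans hn⟩
    rintro _ ⟨g, rfl⟩
    exact ⟨_, hf' g⟩
  have hinj : Function.Injective (f.comp (inr : L →* B)) := hfinj.comp inr_injective
  obtain ⟨σ, hσ⟩ := h.homogeneous _ L hL' hL (MonoidHom.ofInjective hinj).symm (by
    intro g k hk
    have : k = MonoidHom.ofInjective hinj ⟨j g, hjL g⟩ := Subtype.ext (hk.trans (hf' g).symm)
    rw [this, MulEquiv.symm_apply_apply])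
  have hσ' : ∀ l : L, σ (f (inr l)) = l := fun l => by
    have := hσ (MonoidHom.ofInjective hinj l)
    rwa [MulEquiv.symm_apply_apply] at this
  have hσj : ∀ g, σ (j g) = j g := fun g => by
    have := hσ' ⟨j g, hjL g⟩
    rwa [hf'] at this
  have hCE'' := hCE'.map (f := σ.toMonoidHom) σ.injective
  have hL'' : (f.comp (inr : L →* B)).range.map σ.toMonoidHom = L := by
    rw [MonoidHom.map_range]
    ext x
    constructor
    · rintro ⟨l, rfl⟩
      change σ (f (inr l)) ∈ L
      rw [hσ']
      exact l.2
    · intro hx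
      exact ⟨⟨x, hx⟩, hσ' _⟩
  rw [hL''] at hCE''
  have hv' : σ.toMonoidHom (f (inr ⟨v, hv⟩)) = v := hσ' _
  rw [hv'] at hCE''
  exact ⟨_, _, hCE'', IsICESubgroup.map ⟨h1, M, hM, n, hn⟩ σ hσj⟩

theorem IsICEFraisseLimit.exists_mulEquiv {H₁ H₂ : Type u} [Group H₁] [Group H₂] {j₁ : G →* H₁}
    {j₂ : G →* H₂} (h₁ : IsICEFraisseLimit j₁) (h₂ : IsICEFraisseLimit j₂) :
    ∃ e : H₁ ≃* H₂, ∀ g : G, e (j₁ g) = j₂ g := by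
  have := h₁.countable
  have := h₂.countable
  obtain ⟨M₁, hM₁⟩ := h₁.chain
  obtain ⟨M₂, hM₂⟩ := h₂.chain
  have i₁ := (subgroupMemICE_iff.mp (hM₁.mem 0)).1
  have i₂ := (subgroupMemICE_iff.mp (hM₂.mem 0)).1
  -- Back and forth starts from the identification of the two copies of G, so the resulting
  -- isomorphism is compatible with `j₁` and `j₂`.
  obtain ⟨σ, hσ⟩ := exists_mulEquiv_extending h₁.hasCentralizerExtensions
    (isExhaustive_isICESubgroup j₁) h₂.hasCentralizerExtensions (isExhaustive_isICESubgroup j₂)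
    hM₁.isICESubgroup_range hM₂.isICESubgroup_range
    ((MonoidHom.ofInjective i₁).symm.trans (MonoidHom.ofInjective i₂))
  refine ⟨σ, fun g => ?_⟩
  have := hσ (MonoidHom.ofInjective i₁ g)
  rw [MulEquiv.trans_apply, MulEquiv.symm_apply_apply] at this
  exact this

end FraisseLimit

end

/-! ### Unions of sequences of embeddings -/

section DirectLimit

variable {A : ℕ → Type u} [∀ n, Group (A n)] (φ : ∀ n, A n →* A (n + 1))

/-- The composites of a sequence of homomorphisms. -/
def natTransition (m n : ℕ) (h : m ≤ n) : A m →* A n :=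
  Nat.leRecOn h (fun {k} (g : A m →* A k) => (φ k).comp g) (MonoidHom.id (A m))

theorem natTransition_self (m : ℕ) : natTransition φ m m le_rfl = MonoidHom.id (A m) :=
  Nat.leRecOn_self _

theorem natTransition_succ (m n : ℕ) (h : m ≤ n) :
    natTransition φ m (n + 1) (h.trans n.le_succ) = (φ n).comp (natTransition φ m n h) :=
  Nat.leRecOn_succ h _

instance directedSystem_natTransition : DirectedSystem A (natTransition φ · · ·) where
  map_self m x := by rw [natTransition_self]; rfl
  map_map k n m hmn hnk x := by
    induction k, hnk using Nat.le_induction with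
    | base => rw [natTransition_self]; rfl
    | succ k hnk ih =>
      rw [natTransition_succ φ n k hnk, natTransition_succ φ m k (hmn.trans hnk),
        MonoidHom.comp_apply, MonoidHom.comp_apply, ih]

theorem exists_directLimit (hφ : ∀ n, Function.Injective (φ n)) :
    ∃ (H : Type u) (_ : Group H) (ψ : ∀ n, A n →* H), (∀ n, Function.Injective (ψ n)) ∧
      (∀ n a, ψ (n + 1) (φ n a) = ψ n a) ∧ ∀ h, ∃ n a, ψ n a = h := by
  have hinj : ∀ m n h, Function.Injective (natTransition φ m n h) := fun m n h => by
    induction n, h using Nat.le_induction with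
    | base => rw [natTransition_self]; exact Function.injective_id
    | succ n h ih =>
      rw [natTransition_succ φ m n h]
      exact (hφ n).comp ih
  refine ⟨DirectLimit A (natTransition φ), inferInstance, fun n =>
    MonoidHom.mk' (fun a => ⟦⟨n, a⟩⟧) fun a b => (DirectLimit.mul_def n a b).symm,
    fun n => DirectLimit.mk_injective (natTransition φ) hinj n, fun n a => ?_, fun h => ?_⟩
  · refine Eq.trans ?_ (DirectLimit.eq_of_le (f := natTransition φ) ⟨n, a⟩ (n + 1) n.le_succ).symm
    rw [natTransition_succ φ n n le_rfl, natTransition_self]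
    rfl
  · induction h using DirectLimit.induction with
    | _ n a => exact ⟨n, a, rfl⟩

end DirectLimit

/-! ### A tower in which every centralizer keeps growing -/

section Tower

open SemidirectProduct

instance {A : Type*} [Group A] (v : A) [Countable A] : Countable (CosetFreeProduct A v) := by
  have : Countable (A ⧸ Subgroup.centralizer {v}) := QuotientGroup.mk_surjective.countable
  have : Countable (FreeGroup (A ⧸ Subgroup.centralizer {v})) :=
    Function.Surjective.countable (f := FreeGroup.mk) Quot.mk_surjective
  exact SemidirectProduct.equivProd.injective.countable

/-- A countable nontrivial torsion-free CSA group with a sequence of elements. -/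
structure CSAStage where
  /-- The group. -/
  carrier : Type u
  [group : Group carrier]
  countable : Countable carrier
  nontrivial : Nontrivial carrier
  isTorsionFreeCSA : IsTorsionFreeCSA carrier
  /-- The sequence. -/
  queue : ℕ → carrier

attribute [instance] CSAStage.group

/-- Stage n treats the n-th queue entry. Entries whose index unpairs to a first coordinate at most n
are kept, and those with first coordinate n + 1 enumerate the new group. If the entry to be treated
is 1, any nontrivial element is used instead. -/
theorem CSAStage.exists_next (S : CSAStage.{u}) (n : ℕ) :
    ∃ (T : CSAStage.{u}) (φ : S.carrier →* T.carrier), Function.Injective φ ∧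
      (∃ v s, (S.queue n ≠ 1 → v = S.queue n) ∧ IsCE φ.range ⊤ (φ v) s) ∧
      (∀ k, k.unpair.1 ≤ n → T.queue k = φ (S.queue k)) ∧
      ∀ a, ∃ k, k.unpair.1 = n + 1 ∧ T.queue k = a := by
  have := S.countable
  have := S.nontrivial
  obtain ⟨v, hv, hv1⟩ : ∃ v : S.carrier, (S.queue n ≠ 1 → v = S.queue n) ∧ v ≠ 1 := by
    by_cases h : S.queue n = 1
    · obtain ⟨v, hv⟩ := exists_ne (1 : S.carrier)
      exact ⟨v, fun h' => absurd h h', hv⟩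
    · exact ⟨_, fun _ => rfl, h⟩
  obtain ⟨q, hq⟩ := exists_surjective_nat (CosetFreeProduct S.carrier v)
  refine ⟨⟨CosetFreeProduct S.carrier v, inferInstance,
    (inr_injective (φ := _) : Function.Injective
      (inr : S.carrier →* CosetFreeProduct S.carrier v)).nontrivial,
    CosetFreeProduct.isTorsionFreeCSA S.isTorsionFreeCSA hv1,
    fun k => if k.unpair.1 ≤ n then inr (S.queue k) else q k.unpair.2⟩, inr, inr_injective,
    ⟨v, CosetFreeProduct.stable v, hv, isCE_range_inr hv1⟩, fun k hk => if_pos hk, fun a => ?_⟩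
  obtain ⟨b, rfl⟩ := hq a
  exact ⟨Nat.pair (n + 1) b, by simp, by simp⟩

theorem IsTorsionFreeCSA.exists_tower {G : Type u} [Group G] [Countable G] [Nontrivial G]
    (hG : IsTorsionFreeCSA G) :
    ∃ (H : Type u) (_ : Group H) (j : G →* H) (M : ℕ → Subgroup H), IsTorsionFreeCSA H ∧
      Countable H ∧ Function.Injective j ∧ M 0 = j.range ∧
      (∀ n, ∃ v s, IsCE (M n) (M (n + 1)) v s) ∧ (∀ h, ∃ n, h ∈ M n) ∧
      ∀ v : H, v ≠ 1 → ∀ n, ∃ s, Commute s v ∧ s ∉ M n := by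
  choose T φ hφ hv hq hsurj using CSAStage.exists_next.{u}
  obtain ⟨q, hq0⟩ := exists_surjective_nat G
  let S₀ : CSAStage.{u} := ⟨G, inferInstance, inferInstance, hG, fun k => q k.unpair.2⟩
  let S : ℕ → CSAStage.{u} := Nat.rec (motive := fun _ => CSAStage.{u}) S₀ fun n S => T S n
  let χ : ∀ n : ℕ, (S n).carrier →* (S (n + 1)).carrier := fun n => φ (S n) n
  have hqueue : ∀ n (a : (S n).carrier), ∃ k : ℕ, k.unpair.1 = n ∧ (S n).queue k = a := by
    rintro (_ | n) a
    · obtain ⟨b, rfl⟩ := hq0 a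
      exact ⟨Nat.pair 0 b, by simp, congrArg q (by simp)⟩
    · exact hsurj (S n) n a
  obtain ⟨H, _, ψ, hψ, hcomp, hunion⟩ := exists_directLimit χ fun n => hφ (S n) n
  have hCE : ∀ n, ∃ v s, ((S n).queue n ≠ 1 → v = (S n).queue n) ∧
      IsCE (ψ n).range (ψ (n + 1)).range (ψ n v) s := fun n => by
    obtain ⟨v, s, h1, h2⟩ := hv (S n) n
    have h3 := h2.map (hψ (n + 1))
    rw [MonoidHom.map_range, ← MonoidHom.range_eq_map] at h3
    have e : (ψ (n + 1)).comp (φ (S n) n) = ψ n := MonoidHom.ext fun a => hcomp n a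
    rw [e] at h3
    have e' : ψ (n + 1) (φ (S n) n v) = ψ n v := hcomp n v
    rw [e'] at h3
    exact ⟨v, _, h1, h3⟩
  have hmono : Monotone fun n => (ψ n).range := monotone_nat_of_le_succ fun n => by
    obtain ⟨_, _, _, h⟩ := hCE n
    exact h.le
  have hmem : ∀ h, ∃ n, h ∈ (ψ n).range := hunion
  have hcommon : ∀ x y z : H, ∃ n a b c, ψ n a = x ∧ ψ n b = y ∧ ψ n c = z := fun x y z => by
    obtain ⟨p, hp⟩ := hmem x
    obtain ⟨q, hq⟩ := hmem y
    obtain ⟨r, hr⟩ := hmem z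
    obtain ⟨a, ha⟩ := hmono (le_max_left p (max q r)) hp
    obtain ⟨b, hb⟩ := hmono ((le_max_left q r).trans (le_max_right p _)) hq
    obtain ⟨c, hc⟩ := hmono ((le_max_right q r).trans (le_max_right p _)) hr
    exact ⟨_, a, b, c, ha, hb, hc⟩
  refine ⟨H, _, ψ 0, fun n => (ψ n).range, ?_, ?_, hψ 0, rfl, fun n => ?_, hmem, ?_⟩
  · refine ⟨fun x y z hx hyx hxz => ?_, fun x g hx h => ?_, fun x n hn hx h => ?_⟩
    · obtain ⟨n, a, b, c, rfl, rfl, rfl⟩ := hcommon x y z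
      exact ((S n).isTorsionFreeCSA.trans a b c (fun e => hx (by rw [e, map_one]))
        (commute_of_injective (hψ n) hyx) (commute_of_injective (hψ n) hxz)).map (ψ n)
    · obtain ⟨n, a, b, -, rfl, rfl, -⟩ := hcommon x g 1
      rw [← map_inv, ← map_mul, ← map_mul] at h
      exact ((S n).isTorsionFreeCSA.conj a b (fun e => hx (by rw [e, map_one]))
        (commute_of_injective (hψ n) h)).map (ψ n)
    · obtain ⟨m, a, rfl⟩ := hunion x
      refine (S m).isTorsionFreeCSA.pow_ne_one a n hn (fun e => hx (by rw [e, map_one])) (hψ m ?_)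
      rw [map_pow, h, map_one]
  · have : ∀ n, Countable (S n).carrier := fun n => (S n).countable
    have hs : Function.Surjective fun x : Σ n, (S n).carrier => ψ x.1 x.2 := fun h => by
      obtain ⟨n, a, e⟩ := hunion h
      exact ⟨⟨n, a⟩, e⟩
    exact hs.countable
  · obtain ⟨v, s, -, h⟩ := hCE n
    exact ⟨_, s, h⟩
  · intro v hv1 n
    -- Every stage enqueues all its elements anew, so v gets an index k with first coordinate max n
    -- p. That coordinate is at most k, so v is still waiting, and at stage k ≥ n it receives a
    -- letter outside M k.
    obtain ⟨p, hp⟩ := hmem v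
    obtain ⟨a, ha⟩ := hmono (le_max_right n p) hp
    obtain ⟨k, hk, rfl⟩ := hqueue _ a
    have hk' : max n p ≤ k := hk ▸ Nat.unpair_left_le k
    have key : ψ k ((S k).queue k) = v := by
      suffices ∀ m, max n p ≤ m → ψ m ((S m).queue k) = v from this k hk'
      intro m hm
      induction m, hm using Nat.le_induction with
      | base => exact ha
      | succ m hm ih =>
        have e : (S (m + 1)).queue k = φ (S m) m ((S m).queue k) := hq (S m) m k (hk.trans_le hm)
        rw [← ih, e]
        exact hcomp m _
    obtain ⟨w, s, h1, h2⟩ := hCE k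
    obtain rfl := h1 fun e => hv1 (by rw [← key, e, map_one])
    rw [key] at h2
    exact ⟨s, h2.commute_letter.symm, fun h => h2.letter_notMem
      (hmono ((le_max_left n p).trans hk') h)⟩

end Tower

/-! ### The union of the tower is a Fraïssé limit -/

section Existence

variable {G H : Type u} [Group G] [Group H] {j : G →* H}

/-- Only finitely many letters are added, and each lies in some stage. -/
theorem IsICE.le_of_union {K L : Subgroup H} (h : IsICE K L) {M : ℕ → Subgroup H} (hM : Monotone M)
    (hunion : ∀ x, ∃ n, x ∈ M n) (hK : ∃ n, K ≤ M n) : ∃ n, L ≤ M n := by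
  induction h with
  | refl => exact hK
  | tail _ h ih =>
    obtain ⟨v, s, h⟩ := isCEStep_iff.mp h
    obtain ⟨n, hn⟩ := ih
    obtain ⟨m, hm⟩ := hunion s
    exact ⟨max n m, h.le_of_mem (hn.trans (hM (le_max_left n m))) (hM (le_max_right n m) hm)⟩

/-- The chain N witnessing that L is an ICE-subgroup need not be M, but N n lies in some M p. An
element outside M p commuting with v shows that the centralizer of v grows along N above L, and the
letter lemma moves that growth to a first step L(v,s). -/
theorem IsTorsionFreeCSA.hasCentralizerExtensions (hH : IsTorsionFreeCSA H) {M : ℕ → Subgroup H}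
    (hM : IsICEChain j M) (hroots : ∀ v : H, v ≠ 1 → ∀ n, ∃ s, Commute s v ∧ s ∉ M n) :
    HasCentralizerExtensions (IsICESubgroup j) := by
  rintro L ⟨hjL, N, hN, n, hn⟩ v hv hv1
  have hmono : Monotone M := fun m n h => (hM.isICE h).le
  have hN' := (subgroupMemICE_iff.mp (hN.mem n)).2
  obtain ⟨p, hp⟩ := hN'.le_of_union hmono hM.union
    ⟨0, (subgroupMemICE_iff.mp (hM.mem 0)).2.le⟩
  obtain ⟨x, hxv, hx⟩ := hroots v hv1 p
  obtain ⟨m, hm⟩ := hN.union x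
  have hL := hn.trans (hN.isICE (le_max_left n m))
  obtain ⟨r, hr⟩ := isICE_iff.mp hL
  obtain ⟨r', -, L', s, hL', hr'⟩ := hr.exists_letter hH hv hv1
    ((hN.isICE (le_max_right n m)).le hm) hxv (fun h => hx (hp (hn.le h)))
  exact ⟨L', s, hL', hjL.trans hL'.le, N, hN, _, hr'.isICE⟩

theorem IsTorsionFreeCSA.isICEFraisseLimit [Countable H] (hH : IsTorsionFreeCSA H)
    {M : ℕ → Subgroup H} (hM : IsICEChain j M)
    (hroots : ∀ v : H, v ≠ 1 → ∀ n, ∃ s, Commute s v ∧ s ∉ M n) : IsICEFraisseLimit j where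
  countable := inferInstance
  chain := ⟨M, hM⟩
  age A _ ι := by
    have hj := (subgroupMemICE_iff.mp (hM.mem 0)).1
    constructor
    · rintro ⟨K, ⟨hjK, N, hN, n, hn⟩, e, he⟩
      -- Cancellation: both G and K have N n as an iterated extension, so K is an iterated extension
      -- of G.
      have hK : IsICE j.range K := (subgroupMemICE_iff.mp (hN.mem n)).2.of_isICE_of_le hH hn hjK
      have hf : Function.Injective (K.subtype.comp e.toMonoidHom) :=
        K.subtype_injective.comp e.injective
      have hι : (K.subtype.comp e.toMonoidHom).comp ι = j := MonoidHom.ext he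
      refine ⟨fun x y h => hj ?_, (isICE_map_iff hf).mp ?_⟩
      · rw [← he, ← he, h]
      · rw [MonoidHom.map_range, hι, ← Subgroup.map_map, ← MonoidHom.range_eq_map,
          (MonoidHom.range_eq_top (f := e.toMonoidHom)).mpr e.surjective, ← MonoidHom.range_eq_map, Subgroup.range_subtype]
        exact hK
    · rintro ⟨hι, hA⟩
      -- The tower of A over G is copied letter by letter among the ICE-subgroups, starting from the
      -- image of G.
      obtain ⟨L, hL, f, hf⟩ := (hH.hasCentralizerExtensions hM hroots).exists_extend hA
        hM.isICESubgroup_range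
        ((MonoidHom.ofInjective hι).symm.trans (MonoidHom.ofInjective hj))
      refine ⟨L, hL, Subgroup.topEquiv.symm.trans f, fun g => (hf (ι g) ⟨g, rfl⟩).trans ?_⟩
      have : (⟨ι g, g, rfl⟩ : ι.range) = MonoidHom.ofInjective hι g := rfl
      rw [this, MulEquiv.trans_apply, MulEquiv.symm_apply_apply]
      rfl
  homogeneous K L hK hL f _ := by
    have hP := hH.hasCentralizerExtensions hM hroots
    exact exists_mulEquiv_extending hP (isExhaustive_isICESubgroup j) hP
      (isExhaustive_isICESubgroup j) hK hL f

theorem IsTorsionFreeCSA.exists_isICEFraisseLimit [Countable G] [Nontrivial G]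
    (hG : IsTorsionFreeCSA G) :
    ∃ (H : Type u) (_ : Group H) (j : G →* H), IsICEFraisseLimit j := by
  obtain ⟨H, _, j, M, hH, _, hj, h0, hstep, hunion, hroots⟩ := hG.exists_tower
  have hstep' : ∀ n, IsICE (M n) (M (n + 1)) := fun n => by
    obtain ⟨v, s, h⟩ := hstep n
    exact h.isICE
  have hM : IsICEChain j M := ⟨fun n => subgroupMemICE_iff.mpr ⟨hj, by
    induction n with
    | zero => exact h0 ▸ Relation.ReflTransGen.refl
    | succ n ih => exact ih.trans (hstep' n)⟩, hstep', hunion⟩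
  exact ⟨H, _, j, hH.isICEFraisseLimit hM hroots⟩

end Existence

theorem mainTheorem4 (G : Type u) [Group G] [Countable G]
    (hnonabelian : ∃ a b : G, a * b ≠ b * a)
    (htorsionfree : IsTorsionFreeGroup G)
    (hCSA : IsCSAGroup G) :
    (∃ (H : Type u) (_ : Group H) (j : G →* H), IsICEFraisseLimit j) ∧
    (∀ (H₁ H₂ : Type u) [Group H₁] [Group H₂] (j₁ : G →* H₁) (j₂ : G →* H₂),
      IsICEFraisseLimit j₁ → IsICEFraisseLimit j₂ →
        ∃ e : H₁ ≃* H₂, ∀ g : G, e (j₁ g) = j₂ g) := by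
  obtain ⟨a, b, hab⟩ := hnonabelian
  have : Nontrivial G := ⟨a, 1, fun h => hab (by rw [h, one_mul, mul_one])⟩
  exact ⟨(isTorsionFreeCSA_of_isCSAGroup htorsionfree hCSA).exists_isICEFraisseLimit,
    fun _ _ _ _ _ _ h₁ h₂ => h₁.exists_mulEquiv h₂⟩
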